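/- Let $J>0$, $h,t\in\mathbb R$ and $m\in\{0,1,2,\dots\}$. On $(\mathbb C^2)^{\otimes L}$ consider the periodic XX Hamiltonian $$H_L=J\sum_{j=1}^{L}\bigl(\sigma^x_{j-1}\sigma^x_j+\sigma^y_{j-1}\sigma^y_j\bigr)-\frac h2\sum_{j=1}^{L}\sigma^z_j ,\qquad \sigma_0^\alpha=\sigma_L^\alpha .$$ For inverse temperature $\beta=1/T\ge 0$ (with $\beta=0$ meaning $T=\infty$) put $\langle A\rangle_{L,T}=\operatorname{tr}(e^{-\beta H_L}A)/\operatorname{tr}(e^{-\beta H_L})$ and $A(t)=e^{itH_L}Ae^{-itH_L}$. Define the thermodynamic limits $$\mathfrak m(T,h)=\lim_{L\to\infty}\frac1L\Bigl\langle\tfrac12\sum_{j=1}^L\sigma_j^z\Bigr\rangle_{L,T},\quad \langle\sigma_1^z\sigma_{m+1}^z(t)\rangle_T=\lim_{L\to\infty}\langle\sigma_1^z\,\sigma_{m+1}^z(t)\rangle_{L,T},\quad \langle\sigma_1^z\sigma_{m+1}^z\rangle_T=\lim_{L\to\infty}\langle\sigma_1^z\,\sigma_{m+1}^z\rangle_{L,T},$$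 and let $\varepsilon(p)=h-4J\cos p$. For every $0<T<\infty$ these three limits exist, and: 1. (Magnetization) $\displaystyle \mathfrak m(T,h)=\int_{-\pi}^{\pi}\frac{dp}{4\pi}\tanh\Bigl(\frac{\varepsilon(p)}{2T}\Bigr)$. 2. (Longitudinal dynamical correlation function) $$\langle\sigma_1^z\sigma_{m+1}^z(t)\rangle_T=4\mathfrak m^2(T,h)+\biggl[\int_{-\pi}^{\pi}\frac{dp}{\pi}\frac{e^{i(mp-t\varepsilon(p))}}{1+e^{\varepsilon(p)/T}}\biggr]\biggl[\int_{-\pi}^{\pi}\frac{dp}{\pi}\frac{e^{-i(mp-t\varepsilon(p))}}{1+e^{-\varepsilon(p)/T}}\biggr].$$ 3. (Static case) $$\langle\sigma_1^z\sigma_{m+1}^z\rangle_T=4\mathfrak m^2(T,h)+\delta_{m,0}\bigl(2-4\mathfrak m(T,h)\bigr)-\biggl|\int_{-\pi}^{\pi}\frac{dp}{\pi}\frac{e^{imp}}{1+e^{\varepsilon(p)/T}}\biggr|^2,$$ and $\langle\sigma_1^z\sigma_{m+1}^z(t)\rangle_T\to\langle\sigma_1^z\sigma_{m+1}^z\rangle_T$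 as $t\to0$. 4. (Infinite temperature) The limit defining $\langle\sigma_1^z\sigma_{m+1}^z(t)\rangle_\infty$ (at $1/T=0$) exists, and $$\langle\sigma_1^z\sigma_{m+1}^z(t)\rangle_\infty=\lim_{T\to\infty}\langle\sigma_1^z\sigma_{m+1}^z(t)\rangle_T=J_m^2(4Jt),$$ where $J_m(x)=\sum_{k\ge0}\frac{(-1)^k}{k!\,(k+m)!}\bigl(\frac x2\bigr)^{2k+m}$ is the Bessel function of the first kind. -/

import Mathlib

open Filter Topology

noncomputable section

namespace XXChain

/-- The Pauli matrices, in the basis in which index `0` is spin up and index `1` is spin down. -/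
def pauliX : Matrix (Fin 2) (Fin 2) ℂ := !![0, 1; 1, 0]

def pauliY : Matrix (Fin 2) (Fin 2) ℂ := !![0, -Complex.I; Complex.I, 0]

def pauliZ : Matrix (Fin 2) (Fin 2) ℂ := !![1, 0; 0, -1]

/-- Spin configurations of a periodic chain of `L` sites. They label the standard basis of
`(ℂ²)^{⊗ L}`, whose sites are the residues modulo `L`. -/
abbrev Config (L : ℕ) : Type := ZMod L → Fin 2

/-- Linear operators on `(ℂ²)^{⊗ L}`, as matrices in the standard basis. -/
abbrev Op (L : ℕ) : Type := Matrix (Config L) (Config L) ℂ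

/-- `1 ⊗ ⋯ ⊗ x ⊗ ⋯ ⊗ 1` with the local operator `x` in the tensor factor `j`. -/
def site (L : ℕ) [NeZero L] (j : ZMod L) (x : Matrix (Fin 2) (Fin 2) ℂ) : Op L :=
  Matrix.of fun s s' => ∏ k : ZMod L, (if k = j then x else 1) (s k) (s' k)

/-- The Hamiltonian of the XX chain with exchange coupling `J` and magnetic field `h`,
periodic boundary conditions. -/
def hamiltonian (L : ℕ) [NeZero L] (J h : ℝ) : Op L :=
  (J : ℂ) • ∑ j : ZMod L,
      (site L (j - 1) pauliX * site L j pauliX + site L (j - 1) pauliY * site L j pauliY)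
    - ((h : ℂ) / 2) • ∑ j : ZMod L, site L j pauliZ

/-- The canonical average `tr (e^{-β H} A) / tr (e^{-β H})` at inverse temperature `β`. -/
def thermalAvg (L : ℕ) [NeZero L] (J h β : ℝ) (A : Op L) : ℂ :=
  (NormedSpace.exp (-(β : ℂ) • hamiltonian L J h) * A).trace /
    (NormedSpace.exp (-(β : ℂ) • hamiltonian L J h)).trace

/-- Heisenberg time evolution `e^{i t H} A e^{-i t H}`. -/
def heisenberg (L : ℕ) [NeZero L] (J h t : ℝ) (A : Op L) : Op L :=
  NormedSpace.exp ((Complex.I * t) • hamiltonian L J h) * A *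
    NormedSpace.exp (-(Complex.I * t) • hamiltonian L J h)

/-- Thermal average of the magnetization per site, `S^z / L` with `S^z = ½ ∑_j σ_j^z`,
in the chain of length `L`. -/
def finiteMagnetization (L : ℕ) [NeZero L] (J h β : ℝ) : ℂ :=
  thermalAvg L J h β ((1 / 2 : ℂ) • ∑ j : ZMod L, site L j pauliZ) / L

/-- `⟨σ_1^z σ_{m+1}^z(t)⟩` in the chain of length `L`. The sites `1, …, L` are the residues
`0, …, L - 1`. -/
def finiteDynCorr (L : ℕ) [NeZero L] (J h β t : ℝ) (m : ℕ) : ℂ :=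
  thermalAvg L J h β
    (site L 0 pauliZ * heisenberg L J h t (site L (m : ZMod L) pauliZ))

/-- `⟨σ_1^z σ_{m+1}^z⟩` in the chain of length `L`. -/
def finiteStaticCorr (L : ℕ) [NeZero L] (J h β : ℝ) (m : ℕ) : ℂ :=
  thermalAvg L J h β (site L 0 pauliZ * site L (m : ZMod L) pauliZ)

/-- Thermodynamic limits `L → ∞` (the chain has length `L = n + 1`). That these limits exist
has to be stated separately. -/
def magnetization (J h β : ℝ) : ℂ :=
  limUnder atTop fun n : ℕ => finiteMagnetization (n + 1) J h β

def dynCorr (J h β t : ℝ) (m : ℕ) : ℂ :=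
  limUnder atTop fun n : ℕ => finiteDynCorr (n + 1) J h β t m

def staticCorr (J h β : ℝ) (m : ℕ) : ℂ :=
  limUnder atTop fun n : ℕ => finiteStaticCorr (n + 1) J h β m

/-- The one-particle energy as a function of the momentum. -/
def energy (J h p : ℝ) : ℝ := h - 4 * J * Real.cos p

/-- The Bessel function of the first kind `J_m` of order `m`, by its power series. -/
def besselJ (m : ℕ) (x : ℝ) : ℝ :=
  ∑' k : ℕ, (-1) ^ k / ((k.factorial : ℝ) * ((k + m).factorial : ℝ)) * (x / 2) ^ (2 * k + m)

end XXChain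

end

/-! The chain is a gas of free fermions up to a boundary sign, and that sign is invisible in the
thermodynamic limit.

Down spins are the particles. The Jordan–Wigner strings turn every hopping term into a fermion
bilinear, except on the bond closing the chain, where a factor `-P` appears, `P = fugacity (-1)`
being the particle parity. On the range of `1 + σ P` the Hamiltonian therefore agrees with a
free-fermion Hamiltonian with boundary phase `-σ` (`hamiltonian_mul_sector`). Adding `σ = 1` and `σ
= -1` writes twice a thermal trace as a combination of four free-fermion traces weighted by `z ^ N`,
with `z = ±1` (`trace_exp_hamiltonian_mul`).

For a fixed boundary phase `κ`, plane waves with `w ^ L = κ` are eigenvectors of the commutator with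
the Hamiltonian, so the density matrix exchanges with a creation mode at the cost of a scalar.
Together with cyclicity of the trace this yields Wick's theorem (`trace_two_point`,
`trace_four_point`), and, through the logarithmic derivative in `z`, also the partition function
(`twistedTrace_one`).

The traces with `z = 1` give averages over the allowed momenta. Both momentum lattices produce
Riemann sums of the same integrals, so the relative weight of the sectors need not be known
(`tendsto_weighted_average`). The traces with `z = -1` are exponentially small relative to the
partition function of the same sector, because `|1 - y| / (1 + y)` is bounded below one for the
Boltzmann weights `y`. Wick's theorem breaks down when some `1 + z y` vanishes, which may happen at
`z = -1`; the estimates are therefore proved for generic `z` in a form where the product of the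
factors `1 + z y` has absorbed all poles, and are then extended by continuity
(`norm_prod_mul_pair_le`, `norm_neg_one_le_of_generic`). `tendsto_sector_ratio` combines the pieces.

What remains is the evaluation of integrals: orthogonality of exponentials at `t = 0`, the Bessel
series (`integral_exp_cos`) at `β = 0`, and joint continuity of the limit in `β` and `t` for the two
limit statements. -/

namespace XXChain

noncomputable section

/-! ### Product operators -/

section Tensor

variable {L : ℕ} [NeZero L]

/-- The product operator `⊗ₖ f k`. -/
def tensor (f : ZMod L → Matrix (Fin 2) (Fin 2) ℂ) : Op L :=
  Matrix.of fun s s' => ∏ k : ZMod L, f k (s k) (s' k)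

lemma site_eq_tensor (j : ZMod L) (x : Matrix (Fin 2) (Fin 2) ℂ) :
    site L j x = tensor fun k => if k = j then x else 1 := rfl

lemma tensor_mul (f g : ZMod L → Matrix (Fin 2) (Fin 2) ℂ) :
    tensor f * tensor g = tensor fun k => f k * g k := by
  ext s s'
  simp only [tensor, Matrix.mul_apply, Matrix.of_apply, ← Finset.prod_mul_distrib]
  rw [Finset.prod_univ_sum, Fintype.piFinset_univ]

lemma tensor_smul (c : ZMod L → ℂ) (f : ZMod L → Matrix (Fin 2) (Fin 2) ℂ) :
    tensor (fun k => c k • f k) = (∏ k, c k) • tensor f := by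
  ext s s'
  simp [tensor, Finset.prod_mul_distrib]

lemma tensor_one : tensor (fun _ : ZMod L => (1 : Matrix (Fin 2) (Fin 2) ℂ)) = 1 := by
  ext s s'
  simp only [tensor, Matrix.of_apply, Matrix.one_apply]
  rw [Finset.prod_ite_zero]
  simp [funext_iff]

/-- All signs and powers of the fugacity in the Jordan–Wigner calculus arise at a single site; this
is how they are extracted. -/
lemma tensor_single_smul (j : ZMod L) (c : ℂ) {f g : ZMod L → Matrix (Fin 2) (Fin 2) ℂ}
    (hj : f j = c • g j) (h : ∀ k, k ≠ j → f k = g k) : tensor f = c • tensor g := by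
  have : f = fun k => (if k = j then c else 1) • g k := by
    funext k
    by_cases hk : k = j
    · subst hk; simp [hj]
    · simp [hk, h k hk]
  rw [this, tensor_smul]
  simp

lemma tensor_single_add (j : ZMod L) {f g e : ZMod L → Matrix (Fin 2) (Fin 2) ℂ}
    (hj : e j = f j + g j) (hf : ∀ k, k ≠ j → f k = e k) (hg : ∀ k, k ≠ j → g k = e k) :
    tensor e = tensor f + tensor g := by
  ext s s'
  simp only [tensor, Matrix.of_apply, Matrix.add_apply]
  rw [← Finset.mul_prod_erase _ _ (Finset.mem_univ j), ← Finset.mul_prod_erase _ _ (Finset.mem_univ j),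
    ← Finset.mul_prod_erase _ (fun k => g k (s k) (s' k)) (Finset.mem_univ j), hj, Matrix.add_apply, add_mul]
  congr 2
  · refine Finset.prod_congr rfl fun k hk => ?_
    rw [hf k (Finset.ne_of_mem_erase hk)]
  · refine Finset.prod_congr rfl fun k hk => ?_
    rw [hg k (Finset.ne_of_mem_erase hk)]

lemma site_add (j : ZMod L) (x y : Matrix (Fin 2) (Fin 2) ℂ) :
    site L j (x + y) = site L j x + site L j y :=
  tensor_single_add j (by simp) (fun k hk => by simp [hk]) (fun k hk => by simp [hk])

lemma site_smul (j : ZMod L) (c : ℂ) (x : Matrix (Fin 2) (Fin 2) ℂ) :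
    site L j (c • x) = c • site L j x :=
  tensor_single_smul j c (by simp) (fun k hk => by simp [hk])

lemma site_one (j : ZMod L) : site L j 1 = 1 := by
  rw [site_eq_tensor, ← tensor_one]; simp

/-! ### The Jordan–Wigner transformation -/

/-- The local operator turning spin up into spin down. -/
def lowerSpin : Matrix (Fin 2) (Fin 2) ℂ := !![0, 0; 1, 0]

/-- The local operator turning spin down into spin up. -/
def raiseSpin : Matrix (Fin 2) (Fin 2) ℂ := !![0, 1; 0, 0]

lemma pauliZ_sq : pauliZ * pauliZ = 1 := by
  ext i j; fin_cases i <;> fin_cases j <;> simp [pauliZ]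

lemma pauliZ_mul_lowerSpin : pauliZ * lowerSpin = -lowerSpin := by
  ext i j; fin_cases i <;> fin_cases j <;> simp [pauliZ, lowerSpin]

lemma lowerSpin_mul_pauliZ : lowerSpin * pauliZ = lowerSpin := by
  ext i j; fin_cases i <;> fin_cases j <;> simp [pauliZ, lowerSpin]

lemma pauliZ_mul_raiseSpin : pauliZ * raiseSpin = raiseSpin := by
  ext i j; fin_cases i <;> fin_cases j <;> simp [pauliZ, raiseSpin]

lemma raiseSpin_mul_pauliZ : raiseSpin * pauliZ = -raiseSpin := by
  ext i j; fin_cases i <;> fin_cases j <;> simp [pauliZ, raiseSpin]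

lemma lowerSpin_mul_raiseSpin_add :
    lowerSpin * raiseSpin + raiseSpin * lowerSpin = 1 := by
  ext i j; fin_cases i <;> fin_cases j <;> simp [raiseSpin, lowerSpin]

lemma lowerSpin_sq : lowerSpin * lowerSpin = 0 := by
  ext i j; fin_cases i <;> fin_cases j <;> simp [lowerSpin]

lemma raiseSpin_sq : raiseSpin * raiseSpin = 0 := by
  ext i j; fin_cases i <;> fin_cases j <;> simp [raiseSpin]

lemma pauliZ_eq : pauliZ = 1 + (-2 : ℂ) • (lowerSpin * raiseSpin) := by
  ext i j; fin_cases i <;> fin_cases j <;> simp [raiseSpin, lowerSpin, pauliZ]; norm_num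

/-- The local operator `x` at site `j` behind a string of `σᶻ` on the sites before `j`. -/
def jordanWigner (j : ZMod L) (x : Matrix (Fin 2) (Fin 2) ℂ) : Op L :=
  tensor fun k => if k.val < j.val then pauliZ else if k = j then x else 1

lemma jordanWigner_mul_self (j : ZMod L) (x y : Matrix (Fin 2) (Fin 2) ℂ) :
    jordanWigner j x * jordanWigner j y = site L j (x * y) := by
  simp only [jordanWigner, site_eq_tensor, tensor_mul]
  congr 1; funext k
  split_ifs with h1 h2 <;> simp_all [pauliZ_sq]

/-- The string attached to `j` passes over site `i`, where `σᶻ` meets `x` and gives the only sign;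
at every other site the two factors commute, since one of them is the identity or both are `σᶻ`. -/
lemma jordanWigner_anticomm_of_lt {i j : ZMod L} (h : i.val < j.val)
    {x : Matrix (Fin 2) (Fin 2) ℂ} (y : Matrix (Fin 2) (Fin 2) ℂ)
    (hx : x * pauliZ = -(pauliZ * x)) :
    jordanWigner i x * jordanWigner j y = -(jordanWigner j y * jordanWigner i x) := by
  simp only [jordanWigner, tensor_mul]
  rw [← neg_one_smul ℂ]
  refine tensor_single_smul i _ ?_ fun k hk => ?_
  · simp [h, hx]
  · have : ¬ (i.val = k.val) := fun e => hk (ZMod.val_injective L e).symm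
    split_ifs <;> first | (subst_vars; omega) | simp_all

lemma jordanWigner_anticomm {i j : ZMod L} (h : i ≠ j)
    {x y : Matrix (Fin 2) (Fin 2) ℂ}
    (hx : x * pauliZ = -(pauliZ * x)) (hy : y * pauliZ = -(pauliZ * y)) :
    jordanWigner i x * jordanWigner j y + jordanWigner j y * jordanWigner i x = 0 := by
  rcases lt_or_gt_of_ne (fun e => h (ZMod.val_injective L e)) with h | h
  · rw [jordanWigner_anticomm_of_lt h y hx]; abel
  · rw [jordanWigner_anticomm_of_lt h x hy]; abel

/-- Fermionic creation operators; the particles are the down spins. -/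
def cre (j : ZMod L) : Op L := jordanWigner j lowerSpin

/-- Fermionic annihilation operators. -/
def ann (j : ZMod L) : Op L := jordanWigner j raiseSpin

lemma lowerSpin_anticomm : lowerSpin * pauliZ = -(pauliZ * lowerSpin) := by
  rw [lowerSpin_mul_pauliZ, pauliZ_mul_lowerSpin, neg_neg]

lemma raiseSpin_anticomm : raiseSpin * pauliZ = -(pauliZ * raiseSpin) := by
  rw [raiseSpin_mul_pauliZ, pauliZ_mul_raiseSpin]

lemma site_zero (j : ZMod L) : site L j 0 = 0 := by
  simpa using site_smul j 0 (0 : Matrix (Fin 2) (Fin 2) ℂ)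

lemma cre_cre (i j : ZMod L) : cre i * cre j + cre j * cre i = 0 := by
  by_cases h : i = j
  · subst h; simp [cre, jordanWigner_mul_self, lowerSpin_sq, site_zero]
  · exact jordanWigner_anticomm h lowerSpin_anticomm lowerSpin_anticomm

lemma ann_ann (i j : ZMod L) : ann i * ann j + ann j * ann i = 0 := by
  by_cases h : i = j
  · subst h; simp [ann, jordanWigner_mul_self, raiseSpin_sq, site_zero]
  · exact jordanWigner_anticomm h raiseSpin_anticomm raiseSpin_anticomm

lemma cre_ann (i j : ZMod L) :
    cre i * ann j + ann j * cre i = if i = j then 1 else 0 := by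
  split_ifs with h
  · subst h
    rw [cre, ann, jordanWigner_mul_self, jordanWigner_mul_self, ← site_add,
      lowerSpin_mul_raiseSpin_add, site_one]
  · exact jordanWigner_anticomm h lowerSpin_anticomm raiseSpin_anticomm

lemma site_pauliZ (j : ZMod L) : site L j pauliZ = 1 + (-2 : ℂ) • (cre j * ann j) := by
  rw [cre, ann, jordanWigner_mul_self, ← site_smul, ← site_one j, ← site_add, pauliZ_eq]

/-- The operator `z ^ N`, with `N` the number of down spins. -/
def fugacity (z : ℂ) : Op L := tensor fun _ => !![1, 0; 0, z]

/-- Creation adds one down spin; the string is diagonal and commutes with the fugacity. -/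
lemma fugacity_mul_cre (z : ℂ) (j : ZMod L) : fugacity z * cre j = z • (cre j * fugacity z) := by
  simp only [fugacity, cre, jordanWigner, tensor_mul]
  refine tensor_single_smul j _ ?_ fun k hk => ?_
  · ext a b; fin_cases a <;> fin_cases b <;> simp [lowerSpin]
  · simp only [hk, if_false]
    split_ifs
    · ext a b; fin_cases a <;> fin_cases b <;> simp [pauliZ]
    · simp

lemma ann_mul_fugacity (z : ℂ) (j : ZMod L) : ann j * fugacity z = z • (fugacity z * ann j) := by
  simp only [fugacity, ann, jordanWigner, tensor_mul]
  refine tensor_single_smul j _ ?_ fun k hk => ?_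
  · ext a b; fin_cases a <;> fin_cases b <;> simp [raiseSpin]
  · simp only [hk, if_false]
    split_ifs
    · ext a b; fin_cases a <;> fin_cases b <;> simp [pauliZ]
    · simp

lemma fugacity_eq_diagonal (z : ℂ) :
    (fugacity z : Op L) = Matrix.diagonal fun s => z ^ (∑ k, (s k).val) := by
  ext s s'
  have : ∀ a b : Fin 2, !![1, 0; 0, z] a b = if a = b then z ^ a.val else 0 := by
    intro a b; fin_cases a <;> fin_cases b <;> simp
  simp only [fugacity, tensor, Matrix.of_apply, this, Matrix.diagonal_apply]
  rw [Finset.prod_ite_zero]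
  simp [funext_iff, Finset.prod_pow_eq_pow_sum]

lemma fugacity_one : (fugacity 1 : Op L) = 1 := by
  rw [fugacity_eq_diagonal]; simp

lemma fugacity_mul_fugacity (z w : ℂ) :
    (fugacity z * fugacity w : Op L) = fugacity (z * w) := by
  rw [fugacity_eq_diagonal, fugacity_eq_diagonal, fugacity_eq_diagonal, Matrix.diagonal_mul_diagonal]
  simp [mul_pow]

lemma fugacity_comm_cre_ann (z : ℂ) (i j : ZMod L) :
    fugacity z * (cre i * ann j) = cre i * ann j * fugacity z := by
  rw [← mul_assoc, fugacity_mul_cre, mul_assoc, ann_mul_fugacity, mul_smul_comm, smul_mul_assoc,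
    mul_assoc]

lemma fugacity_comm_site_pauliZ (z : ℂ) (j : ZMod L) :
    fugacity z * site L j pauliZ = site L j pauliZ * fugacity z := by
  rw [site_pauliZ, mul_add, add_mul, mul_smul_comm, smul_mul_assoc, fugacity_comm_cre_ann]; simp

/-! ### Hopping terms -/

lemma val_sub_one {j : ZMod L} (hj : j ≠ 0) : (j - 1).val + 1 = j.val := by
  have h0 : j.val ≠ 0 := by rwa [Ne, ZMod.val_eq_zero]
  have hlt := ZMod.val_lt j
  have : Fact (1 < L) := ⟨by omega⟩
  rw [ZMod.val_sub (by rw [ZMod.val_one]; omega), ZMod.val_one]; omega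

lemma val_zero_sub_one : ((0 : ZMod L) - 1).val + 1 = L := by
  obtain ⟨n, rfl⟩ : ∃ n, L = n + 1 := ⟨L - 1, (Nat.succ_pred (NeZero.ne L)).symm⟩
  rw [zero_sub, ZMod.val_neg_one]

/-- For neighbours in the linear order of the residues the two strings cancel up to one `σᶻ` at site
`j - 1`, which the spin operator there absorbs without a sign. -/
lemma cre_sub_one_mul_ann {j : ZMod L} (hj : j ≠ 0) :
    cre (j - 1) * ann j = site L (j - 1) lowerSpin * site L j raiseSpin := by
  have hv := val_sub_one hj
  simp only [cre, ann, jordanWigner, site_eq_tensor, tensor_mul]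
  congr 1; funext k
  have e1 : k = j - 1 ↔ k.val = (j - 1).val := (ZMod.val_injective L).eq_iff.symm
  have e2 : k = j ↔ k.val = j.val := (ZMod.val_injective L).eq_iff.symm
  simp only [e1, e2]
  split_ifs <;> first | omega | simp [pauliZ_sq, lowerSpin_mul_pauliZ]

lemma cre_mul_ann_sub_one {j : ZMod L} (hj : j ≠ 0) :
    cre j * ann (j - 1) = site L (j - 1) raiseSpin * site L j lowerSpin := by
  have hv := val_sub_one hj
  simp only [cre, ann, jordanWigner, site_eq_tensor, tensor_mul]
  congr 1; funext k
  have e1 : k = j - 1 ↔ k.val = (j - 1).val := (ZMod.val_injective L).eq_iff.symm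
  have e2 : k = j ↔ k.val = j.val := (ZMod.val_injective L).eq_iff.symm
  simp only [e1, e2]
  split_ifs <;> first | omega | simp [pauliZ_sq, pauliZ_mul_raiseSpin]

lemma parity_eq : (fugacity (-1) : Op L) = tensor fun _ => pauliZ := rfl

/-- On the closing bond a string over all sites from `0` to `L - 2` survives. Multiplying by the
parity cancels it between the two ends; the minus sign comes from site `0`. Two sites are needed for
the ends of the bond to differ. -/
lemma wrap_lowerSpin_raiseSpin (hL : 2 ≤ L) :
    site L (0 - 1) lowerSpin * site L 0 raiseSpin
      = -(cre (0 - 1 : ZMod L) * ann 0 * fugacity (-1)) := by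
  have hv := val_zero_sub_one (L := L)
  rw [← neg_one_smul ℂ, parity_eq]
  simp only [cre, ann, jordanWigner, site_eq_tensor, tensor_mul]
  refine tensor_single_smul 0 _ ?_ fun k hk => ?_
  · have : (0 : ZMod L) ≠ 0 - 1 := fun e => by rw [← e, ZMod.val_zero] at hv; omega
    have h2 : 0 < ((0 : ZMod L) - 1).val := by omega
    simp only [ZMod.val_zero, h2, if_true, this, if_false, lt_irrefl]
    simp [raiseSpin_mul_pauliZ, pauliZ_mul_raiseSpin]
  · have e1 : k = 0 - 1 ↔ k.val = ((0 : ZMod L) - 1).val := (ZMod.val_injective L).eq_iff.symm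
    have hlt := ZMod.val_lt k
    simp only [e1, hk, if_false, ZMod.val_zero, Nat.not_lt_zero]
    split_ifs <;> first | omega | simp [pauliZ_sq, lowerSpin_mul_pauliZ]

/-- As for the reverse hop, but here the sign arises at the last site, `raiseSpin` being the factor
that anticommutes past the parity with a sign. -/
lemma wrap_raiseSpin_lowerSpin (hL : 2 ≤ L) :
    site L (0 - 1) raiseSpin * site L 0 lowerSpin
      = -(cre (0 : ZMod L) * ann (0 - 1) * fugacity (-1)) := by
  have hv := val_zero_sub_one (L := L)
  have h01 : (0 : ZMod L) ≠ 0 - 1 := fun e => by rw [← e, ZMod.val_zero] at hv; omega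
  rw [← neg_one_smul ℂ, parity_eq]
  simp only [cre, ann, jordanWigner, site_eq_tensor, tensor_mul]
  refine tensor_single_smul (0 - 1) _ ?_ fun k hk => ?_
  · simp only [ZMod.val_zero, Nat.not_lt_zero, if_true, h01.symm, if_false, lt_irrefl]
    simp [raiseSpin_mul_pauliZ]
  · have e1 : k = 0 - 1 ↔ k.val = ((0 : ZMod L) - 1).val := (ZMod.val_injective L).eq_iff.symm
    have hlt := ZMod.val_lt k
    have hk' := mt e1.2 hk
    simp only [e1, hk', if_false, ZMod.val_zero, Nat.not_lt_zero]
    split_ifs <;> first | omega | simp [pauliZ_sq, lowerSpin_mul_pauliZ]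

lemma xx_add_yy (i j : ZMod L) :
    site L i pauliX * site L j pauliX + site L i pauliY * site L j pauliY =
      (2 : ℂ) • (site L i lowerSpin * site L j raiseSpin + site L i raiseSpin * site L j lowerSpin) := by
  have hx : pauliX = lowerSpin + raiseSpin := by
    ext a b; fin_cases a <;> fin_cases b <;> simp [pauliX, raiseSpin, lowerSpin]
  have hy : pauliY = Complex.I • (lowerSpin + (-1 : ℂ) • raiseSpin) := by
    ext a b; fin_cases a <;> fin_cases b <;> simp [pauliY, raiseSpin, lowerSpin]
  rw [hx, hy]
  have hI : ∀ A B : Op L, (Complex.I • A) * (Complex.I • B) = -(A * B) := fun A B => by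
    rw [smul_mul_smul_comm, Complex.I_mul_I, neg_one_smul]
  simp only [site_add, site_smul, hI]
  simp only [mul_add, add_mul, smul_add, smul_smul, mul_smul_comm, smul_mul_assoc]
  module

end Tensor

/-! ### Exponentials of intertwined matrices -/

section Exponential

variable {n : Type*} [Fintype n] [DecidableEq n]

/-- Intertwining passes to powers and hence to the exponential series. `V` need not be invertible:
it is also applied to `1 + σ P` and to a rank-one matrix unit. -/
lemma exp_mul_eq_mul_exp {x y V : Matrix n n ℂ} (h : x * V = V * y) :
    NormedSpace.exp x * V = V * NormedSpace.exp y := by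
  let _ : SeminormedRing (Matrix n n ℂ) := Matrix.linftyOpSemiNormedRing
  let _ : NormedRing (Matrix n n ℂ) := Matrix.linftyOpNormedRing
  let _ : NormedAlgebra ℂ (Matrix n n ℂ) := Matrix.linftyOpNormedAlgebra
  have hp : ∀ k : ℕ, x ^ k * V = V * y ^ k := fun k => by
    induction k with
    | zero => simp
    | succ k ih => rw [pow_succ, mul_assoc, h, ← mul_assoc, ih, mul_assoc, ← pow_succ]
  have hx := (NormedSpace.exp_series_hasSum_exp' (𝕂 := ℂ) x).mul_right V
  have hy := (NormedSpace.exp_series_hasSum_exp' (𝕂 := ℂ) y).mul_left V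
  simp only [smul_mul_assoc, mul_smul_comm, hp] at hx hy
  exact hx.unique hy

lemma exp_smul_one (c : ℂ) :
    NormedSpace.exp (c • (1 : Matrix n n ℂ)) = Complex.exp c • 1 := by
  rw [Matrix.smul_one_eq_diagonal, Matrix.exp_diagonal, Matrix.smul_one_eq_diagonal]
  congr 1
  funext i
  rw [Pi.coe_exp, Complex.exp_eq_exp_ℂ]

/-- An eigenvector `V` of the commutator with `H` intertwines `H` with `H + e`, and the scalar
splits off the exponential. -/
lemma exp_smul_mul_of_commutator {H V : Matrix n n ℂ} {e : ℂ} (h : H * V = V * H + e • V) (c : ℂ) :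
    NormedSpace.exp (c • H) * V = Complex.exp (c * e) • (V * NormedSpace.exp (c • H)) := by
  have h1 : (c • H) * V = V * (c • H + (c * e) • 1) := by
    rw [smul_mul_assoc, h, mul_add, mul_smul_comm, mul_smul_comm, mul_one, smul_add, smul_smul]
  rw [exp_mul_eq_mul_exp h1, Matrix.exp_add_of_commute _ _ ((Commute.one_right _).smul_right _),
    exp_smul_one, mul_smul_comm, mul_one, mul_smul_comm]

lemma exp_smul_mul_exp_neg_smul (H : Matrix n n ℂ) (c : ℂ) :
    NormedSpace.exp (c • H) * NormedSpace.exp (-c • H) = 1 := by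
  rw [← Matrix.exp_add_of_commute _ _ (((Commute.refl H).smul_right _).smul_left _), ← add_smul]
  simp

end Exponential

/-! ### Hopping Hamiltonians with a twisted boundary condition -/

section Twisted

variable {L : ℕ} [NeZero L]

/-- The phase `κ` on the bond that closes the chain. -/
def twist (κ : ℂ) (j : ZMod L) : ℂ := if j = 0 then κ else 1

/-- The free-fermion Hamiltonian with boundary phase `κ`. -/
def twisted (L : ℕ) [NeZero L] (J h : ℝ) (κ : ℂ) : Op L :=
  (2 * J : ℂ) • ∑ j : ZMod L, twist κ j • (cre (j - 1) * ann j + cre j * ann (j - 1))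
    + (h : ℂ) • ∑ j : ZMod L, cre j * ann j - (h * L / 2 : ℂ) • 1

/-- The parity acts as `σ` on the range of `1 + σ P`, so the factor `-P` on the closing bond becomes
the boundary phase `-σ`: antiperiodic for even particle number, periodic for odd. -/
lemma hamiltonian_mul_sector (hL : 2 ≤ L) (J h : ℝ) {σ : ℂ} (hσ : σ * σ = 1) :
    hamiltonian L J h * (1 + σ • fugacity (-1)) =
      twisted L J h (-σ) * (1 + σ • fugacity (-1)) := by
  have hP : (fugacity (-1) : Op L) * (1 + σ • fugacity (-1)) = σ • (1 + σ • fugacity (-1)) := by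
    rw [mul_add, mul_smul_comm, fugacity_mul_fugacity, smul_add, smul_smul, hσ]
    simp [fugacity_one, add_comm]
  have hbond : ∀ j : ZMod L,
      (site L (j - 1) pauliX * site L j pauliX + site L (j - 1) pauliY * site L j pauliY) *
        (1 + σ • fugacity (-1)) =
      (2 : ℂ) • (twist (-σ) j • (cre (j - 1) * ann j + cre j * ann (j - 1)) *
        (1 + σ • fugacity (-1))) := by
    intro j
    rw [xx_add_yy, smul_mul_assoc]
    congr 1
    by_cases hj : j = 0
    · subst hj
      rw [wrap_lowerSpin_raiseSpin hL, wrap_raiseSpin_lowerSpin hL, ← neg_add, ← add_mul, neg_mul,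
        mul_assoc, hP]
      simp only [twist, if_true, mul_smul_comm, smul_mul_assoc, neg_smul, neg_mul]
    · rw [cre_sub_one_mul_ann hj, cre_mul_ann_sub_one hj]
      simp [twist, hj]
  have hz : ((h : ℂ) / 2) • ∑ j : ZMod L, site L j pauliZ =
      (h * L / 2 : ℂ) • 1 - (h : ℂ) • ∑ j : ZMod L, cre j * ann j := by
    simp only [site_pauliZ, Finset.sum_add_distrib, ← Finset.smul_sum]
    simp only [Finset.sum_const, Finset.card_univ, ZMod.card, ← Nat.cast_smul_eq_nsmul ℂ]
    module
  rw [hamiltonian, hz, twisted, sub_mul, smul_mul_assoc, Finset.sum_mul]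
  simp only [hbond]
  rw [← Finset.smul_sum, ← Finset.sum_mul, smul_smul, sub_mul, sub_mul, add_mul]
  simp only [smul_mul_assoc]
  rw [mul_comm (J : ℂ) 2]
  abel

lemma fugacity_comm_twisted (z : ℂ) (J h : ℝ) (κ : ℂ) :
    Commute (fugacity z) (twisted L J h κ) := by
  have hb : ∀ i j : ZMod L, Commute (fugacity z) (cre i * ann j) := fugacity_comm_cre_ann z
  refine ((Commute.add_right ((Commute.sum_right _ _ _ fun j _ => ?_).smul_right _)
    ((Commute.sum_right _ _ _ fun j _ => hb j j).smul_right _)).sub_right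
      ((Commute.one_right _).smul_right _))
  exact ((hb _ _).add_right (hb _ _)).smul_right _

/-! ### Commutators of the twisted Hamiltonian with site operators and plane waves -/

lemma cre_ann_mul_cre (i j l : ZMod L) :
    cre i * ann j * cre l = cre l * (cre i * ann j) + if j = l then cre i else 0 := by
  have h1 : ann j * cre l = (if l = j then 1 else 0) - cre l * ann j := by
    rw [← cre_ann l j]; abel
  have h2 : cre i * cre l = -(cre l * cre i) := by
    rw [eq_neg_iff_add_eq_zero]; exact cre_cre i l
  rw [mul_assoc, h1, mul_sub, ← mul_assoc, h2]
  by_cases h : j = l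
  · subst h; simp; noncomm_ring
  · simp [h, Ne.symm h]; noncomm_ring

lemma cre_ann_mul_ann (i j l : ZMod L) :
    cre i * ann j * ann l = ann l * (cre i * ann j) - if i = l then ann j else 0 := by
  have h1 : cre i * ann l = (if i = l then 1 else 0) - ann l * cre i := by
    rw [← cre_ann i l]; abel
  have h2 : ann j * ann l = -(ann l * ann j) := by
    rw [eq_neg_iff_add_eq_zero]; exact ann_ann j l
  rw [mul_assoc, h2, mul_neg, ← mul_assoc, h1]
  by_cases h : i = l
  · subst h; simp; noncomm_ring
  · simp [h]; noncomm_ring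

lemma twisted_mul_cre (J h : ℝ) (κ : ℂ) (l : ZMod L) :
    twisted L J h κ * cre l = cre l * twisted L J h κ +
      ((2 * J : ℂ) • (twist κ l • cre (l - 1) + twist κ (l + 1) • cre (l + 1)) + (h : ℂ) • cre l) := by
  have e : ∀ j : ZMod L, (j - 1 = l) = (j = l + 1) := fun j => propext sub_eq_iff_eq_add
  simp only [twisted, sub_mul, mul_sub, add_mul, mul_add, smul_mul_assoc, mul_smul_comm,
    Finset.sum_mul, Finset.mul_sum, cre_ann_mul_cre, smul_add, Finset.sum_add_distrib, e,
    smul_ite, smul_zero, Finset.sum_ite_eq', Finset.mem_univ, if_true, one_mul, mul_one,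
    Finset.smul_sum]
  abel

lemma twisted_mul_ann (J h : ℝ) (κ : ℂ) (l : ZMod L) :
    twisted L J h κ * ann l = ann l * twisted L J h κ -
      ((2 * J : ℂ) • (twist κ l • ann (l - 1) + twist κ (l + 1) • ann (l + 1)) + (h : ℂ) • ann l) := by
  have e : ∀ j : ZMod L, (j - 1 = l) = (j = l + 1) := fun j => propext sub_eq_iff_eq_add
  simp only [twisted, sub_mul, mul_sub, add_mul, mul_add, smul_mul_assoc, mul_smul_comm,
    Finset.sum_mul, Finset.mul_sum, cre_ann_mul_ann, smul_add, smul_sub, Finset.sum_add_distrib, e,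
    Finset.sum_sub_distrib, smul_ite, smul_zero, Finset.sum_ite_eq', Finset.mem_univ, if_true,
    one_mul, mul_one, Finset.smul_sum]
  abel

/-- The plane-wave superposition `∑ⱼ wʲ cⱼ`. -/
def planeWave (w : ℂ) (c : ZMod L → Op L) : Op L := ∑ j, w ^ j.val • c j

/-- The quantisation `w ^ L = κ` is exactly what lets the wave continue across the closing bond,
where the residue jumps from `L - 1` to `0`. -/
lemma twist_mul_pow_succ {κ w : ℂ} (hw : w ^ L = κ) (l : ZMod L) :
    twist κ (l + 1) * w ^ (l + 1).val = w * w ^ l.val := by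
  by_cases h : l + 1 = 0
  · have hl : l = 0 - 1 := by rw [zero_sub]; exact eq_neg_of_add_eq_zero_left h
    have hv := val_zero_sub_one (L := L)
    rw [h, ← pow_succ', hl, hv, hw]
    simp [twist]
  · have hv := val_sub_one h
    rw [add_sub_cancel_right] at hv
    rw [← hv, pow_succ']
    simp [twist, h]

/-- Both hopping directions carry the same phase `κ`, so the backward step needs `κ = κ⁻¹`. -/
lemma twist_mul_pow_pred {κ w : ℂ} (hw : w ^ L = κ) (hκ : κ * κ = 1) (l : ZMod L) :
    twist κ l * w ^ (l - 1).val = w⁻¹ * w ^ l.val := by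
  have h := twist_mul_pow_succ hw (l - 1)
  rw [sub_add_cancel] at h
  have hw0 : w ≠ 0 := by
    rintro rfl
    rw [zero_pow (NeZero.ne L)] at hw
    simp [← hw] at hκ
  have ht : twist κ l * twist κ l = 1 := by
    by_cases hl : l = 0 <;> simp [twist, hl, hκ]
  have h2 : w ^ (l - 1).val = w⁻¹ * (w * w ^ (l - 1).val) := by field_simp
  rw [h2, ← h]
  linear_combination w⁻¹ * w ^ l.val * ht

lemma planeWave_hop {κ w : ℂ} (hw : w ^ L = κ) (hκ : κ * κ = 1) (c : ZMod L → Op L) :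
    planeWave w (fun l => twist κ l • c (l - 1) + twist κ (l + 1) • c (l + 1)) =
      (w + w⁻¹) • planeWave w c := by
  rw [add_smul]
  simp only [planeWave, smul_add, smul_smul, Finset.sum_add_distrib, Finset.smul_sum]
  congr 1
  · refine (Equiv.sum_comp (Equiv.addRight (1 : ZMod L)) _).symm.trans ?_
    refine Finset.sum_congr rfl fun l _ => ?_
    simp only [Equiv.coe_addRight, add_sub_cancel_right]
    rw [mul_comm, twist_mul_pow_succ hw]
  · refine (Equiv.sum_comp (Equiv.subRight (1 : ZMod L)) _).symm.trans ?_
    refine Finset.sum_congr rfl fun l _ => ?_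
    simp only [Equiv.subRight_apply, sub_add_cancel]
    rw [mul_comm, twist_mul_pow_pred hw hκ]

lemma twisted_mul_planeWave_cre (J h : ℝ) {κ w : ℂ} (hw : w ^ L = κ) (hκ : κ * κ = 1) :
    twisted L J h κ * planeWave w cre = planeWave w cre * twisted L J h κ +
      (h + 2 * J * (w + w⁻¹) : ℂ) • planeWave w cre := by
  have h1 := planeWave_hop hw hκ (cre (L := L))
  rw [add_smul, mul_smul, ← h1]
  simp only [planeWave, Finset.mul_sum, Finset.sum_mul, mul_smul_comm, smul_mul_assoc,
    twisted_mul_cre]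
  simp only [smul_add, Finset.sum_add_distrib, Finset.smul_sum, smul_smul, mul_comm, mul_assoc]
  abel

/-- The mode conjugate to `w` uses `w⁻¹`; the dispersion is symmetric under this inversion, so only
the sign of the energy changes. -/
lemma twisted_mul_planeWave_ann (J h : ℝ) {κ w : ℂ} (hw : w ^ L = κ) (hκ : κ * κ = 1) :
    twisted L J h κ * planeWave w⁻¹ ann = planeWave w⁻¹ ann * twisted L J h κ +
      (-(h + 2 * J * (w + w⁻¹)) : ℂ) • planeWave w⁻¹ ann := by
  have hw' : w⁻¹ ^ L = κ := by
    rw [inv_pow, hw]; exact inv_eq_of_mul_eq_one_left hκ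
  have h1 := planeWave_hop hw' hκ (ann (L := L))
  rw [inv_inv, add_comm w⁻¹] at h1
  rw [neg_smul, add_smul, mul_smul, ← h1]
  simp only [planeWave, Finset.mul_sum, Finset.sum_mul, mul_smul_comm, smul_mul_assoc,
    twisted_mul_ann]
  simp only [smul_add, smul_sub, Finset.sum_add_distrib, Finset.sum_sub_distrib, Finset.smul_sum,
    smul_smul, mul_comm, mul_assoc]
  abel

/-! ### Reduction of thermal traces to the two parity sectors -/

/-- Heisenberg evolution under the twisted Hamiltonian. -/
def twistedHeisenberg (L : ℕ) [NeZero L] (J h : ℝ) (κ : ℂ) (t : ℝ) (A : Op L) : Op L :=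
  NormedSpace.exp ((Complex.I * t) • twisted L J h κ) * A *
    NormedSpace.exp (-(Complex.I * t) • twisted L J h κ)

/-- The trace `tr (z ^ N e^{-β H} A)` for the twisted Hamiltonian. -/
def twistedTrace (L : ℕ) [NeZero L] (J h β : ℝ) (κ z : ℂ) (A : Op L) : ℂ :=
  (fugacity z * NormedSpace.exp (-(β : ℂ) • twisted L J h κ) * A).trace

lemma exp_hamiltonian_mul_sector (hL : 2 ≤ L) (J h : ℝ) {σ : ℂ} (hσ : σ * σ = 1) (c : ℂ) :
    NormedSpace.exp (c • hamiltonian L J h) * (1 + σ • fugacity (-1)) =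
      (1 + σ • fugacity (-1)) * NormedSpace.exp (c • twisted L J h (-σ)) := by
  refine exp_mul_eq_mul_exp ?_
  rw [smul_mul_assoc, hamiltonian_mul_sector hL J h hσ, mul_smul_comm]
  congr 1
  exact ((Commute.one_right _).add_right ((fugacity_comm_twisted _ _ _ _).symm.smul_right _))

/-- The two operators `1 + σ P`, `σ = ±1`, add up to `2`. In each sector the term `σ P` produces the
trace at `z = -1`, with opposite signs for the two boundary conditions. -/
lemma trace_exp_hamiltonian_mul (hL : 2 ≤ L) (J h β t : ℝ) {A B : Op L}
    (hA : Commute A (fugacity (-1))) (hB : Commute B (fugacity (-1))) :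
    2 * (NormedSpace.exp (-(β : ℂ) • hamiltonian L J h) * (A * heisenberg L J h t B)).trace =
      (twistedTrace L J h β (-1) 1 (A * twistedHeisenberg L J h (-1) t B) +
        twistedTrace L J h β (-1) (-1) (A * twistedHeisenberg L J h (-1) t B)) +
      (twistedTrace L J h β 1 1 (A * twistedHeisenberg L J h 1 t B) -
        twistedTrace L J h β 1 (-1) (A * twistedHeisenberg L J h 1 t B)) := by
  have key : ∀ σ : ℂ, σ * σ = 1 →
      (NormedSpace.exp (-(β : ℂ) • hamiltonian L J h) * (A * heisenberg L J h t B) *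
        (1 + σ • fugacity (-1))).trace =
      twistedTrace L J h β (-σ) 1 (A * twistedHeisenberg L J h (-σ) t B) +
        σ * twistedTrace L J h β (-σ) (-1) (A * twistedHeisenberg L J h (-σ) t B) := by
    intro σ hσ
    have e := exp_hamiltonian_mul_sector (L := L) hL J h hσ
    have cA : A * (1 + σ • fugacity (-1)) = (1 + σ • fugacity (-1)) * A :=
      (Commute.one_right _).add_right (hA.smul_right _)
    have cB : B * (1 + σ • fugacity (-1)) = (1 + σ • fugacity (-1)) * B :=
      (Commute.one_right _).add_right (hB.smul_right _)
    -- The sector operator is carried from right to left: it commutes with the observables and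
    -- replaces the Hamiltonian by the twisted one in each exponential it crosses.
    have h1 : NormedSpace.exp (-(β : ℂ) • hamiltonian L J h) * (A * heisenberg L J h t B) *
        (1 + σ • fugacity (-1)) = (1 + σ • fugacity (-1)) *
          (NormedSpace.exp (-(β : ℂ) • twisted L J h (-σ)) *
            (A * twistedHeisenberg L J h (-σ) t B)) := by
      rw [heisenberg, mul_assoc, mul_assoc, mul_assoc (_ * B), e, mul_assoc _ B, ← mul_assoc B, cB,
        ← mul_assoc _ (_ * B), ← mul_assoc _ _ B, e, mul_assoc _ _ B, mul_assoc _ (_ * B),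
        ← mul_assoc A, cA, mul_assoc _ A, ← mul_assoc, e, mul_assoc, twistedHeisenberg]
    rw [h1, add_mul, Matrix.trace_add, smul_mul_assoc, Matrix.trace_smul, twistedTrace,
      twistedTrace, fugacity_one, smul_eq_mul]
    simp only [mul_assoc]
  have h1 := key 1 (by ring)
  have h2 := key (-1) (by ring)
  rw [mul_add, Matrix.trace_add, mul_one, mul_smul_comm, Matrix.trace_smul, smul_eq_mul] at h1 h2
  rw [neg_neg] at h2
  linear_combination h1 + h2

end Twisted

/-! ### Wick's theorem from the exchange relation with the density matrix -/

section Wick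

variable {n ι : Type*} [Fintype n] [DecidableEq n]
  {bd b : ι → Matrix n n ℂ} {R : Matrix n n ℂ} {a : ι → ℂ} {ℓ : ℂ}

/-- This is the KMS condition in algebraic form: exchange with `R`, then cyclicity. -/
lemma trace_mul_creation_mul (hR : ∀ k, R * bd k = a k • (bd k * R)) (k : ι) (X : Matrix n n ℂ) :
    (R * (bd k * X)).trace = a k * (R * (X * bd k)).trace := by
  rw [← mul_assoc, hR, smul_mul_assoc, Matrix.trace_smul, smul_eq_mul, mul_assoc,
    Matrix.trace_mul_comm, mul_assoc]

variable [DecidableEq ι]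

/-- Carrying `bd k` once around the trace returns the same trace times `-a k` plus an anticommutator
term; this linear equation is solvable because `1 + a k ≠ 0`. -/
lemma trace_two_point (hR : ∀ k, R * bd k = a k • (bd k * R))
    (hca : ∀ k l, bd k * b l + b l * bd k = if k = l then ℓ • 1 else 0)
    (ha : ∀ k, 1 + a k ≠ 0) (k l : ι) :
    (R * (bd k * b l)).trace = if k = l then ℓ * (a k / (1 + a k)) * R.trace else 0 := by
  have h1 := trace_mul_creation_mul hR k (b l)
  have h2 : b l * bd k = (if k = l then ℓ • 1 else 0) - bd k * b l := by rw [← hca k l]; abel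
  rw [h2, mul_sub, Matrix.trace_sub] at h1
  have hk := ha k
  split_ifs at h1 ⊢ with h
  · rw [mul_smul_comm, mul_one, Matrix.trace_smul, smul_eq_mul] at h1
    field_simp
    linear_combination h1
  · rw [mul_zero, Matrix.trace_zero] at h1
    have : (1 + a k) * (R * (bd k * b l)).trace = 0 := by linear_combination h1
    exact (mul_eq_zero.1 this).resolve_left hk

lemma trace_four_point (hR : ∀ k, R * bd k = a k • (bd k * R))
    (hcc : ∀ k l, bd k * bd l + bd l * bd k = 0)
    (hca : ∀ k l, bd k * b l + b l * bd k = if k = l then ℓ • 1 else 0)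
    (ha : ∀ k, 1 + a k ≠ 0) (k l p q : ι) :
    (R * (bd k * b l * (bd p * b q))).trace =
      ((if k = q then if p = l then ℓ ^ 2 * (a k / (1 + a k)) * (1 - a l / (1 + a l)) else 0 else 0) +
        (if k = l then if p = q then ℓ ^ 2 * (a k / (1 + a k)) * (a p / (1 + a p)) else 0 else 0))
        * R.trace := by
  have swap : ∀ k l, b l * bd k = (if k = l then ℓ • 1 else 0) - bd k * b l := fun k l => by
    rw [← hca k l]; abel
  have hcc' : bd p * bd k = -(bd k * bd p) := by
    rw [eq_neg_iff_add_eq_zero]; exact hcc p k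
  -- Bringing `bd k` back to the front passes three operators: two contractions survive, with `b q`
  -- and with `b l`, and three transpositions leave a minus sign.
  have hX : b l * (bd p * b q) * bd k =
      b l * bd p * (if k = q then ℓ • 1 else 0) + (if k = l then ℓ • 1 else 0) * (bd p * b q)
        - bd k * b l * (bd p * b q) := by
    calc b l * (bd p * b q) * bd k = b l * bd p * (b q * bd k) := by noncomm_ring
      _ = b l * bd p * (if k = q then ℓ • 1 else 0) - b l * (bd p * bd k) * b q := by
        rw [swap k q]; noncomm_ring
      _ = b l * bd p * (if k = q then ℓ • 1 else 0) + (b l * bd k) * (bd p * b q) := by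
        rw [hcc']; noncomm_ring
      _ = _ := by rw [swap k l]; noncomm_ring
  have h1 := trace_mul_creation_mul hR k (b l * (bd p * b q))
  rw [hX, ← mul_assoc (bd k)] at h1
  have hk := ha k
  have hlp : (R * (b l * bd p)).trace =
      if p = l then ℓ * (1 - a l / (1 + a l)) * R.trace else 0 := by
    rw [swap p l, mul_sub, Matrix.trace_sub, trace_two_point hR hca ha]
    split_ifs with h
    · subst h; rw [mul_smul_comm, mul_one, Matrix.trace_smul, smul_eq_mul]; ring
    · simp
  have hpq := trace_two_point hR hca ha p q
  rw [mul_sub, mul_add, Matrix.trace_sub, Matrix.trace_add] at h1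
  have e1 : (R * (b l * bd p * (if k = q then ℓ • 1 else 0))).trace =
      if k = q then ℓ * (R * (b l * bd p)).trace else 0 := by
    split_ifs
    · rw [mul_smul_comm, mul_one, mul_smul_comm, Matrix.trace_smul, smul_eq_mul]
    · simp
  have e2 : (R * ((if k = l then ℓ • 1 else 0) * (bd p * b q))).trace =
      if k = l then ℓ * (R * (bd p * b q)).trace else 0 := by
    split_ifs
    · rw [smul_mul_assoc, one_mul, mul_smul_comm, Matrix.trace_smul, smul_eq_mul]
    · simp
  rw [e1, e2, hlp, hpq] at h1
  have h2 : (R * (bd k * b l * (bd p * b q))).trace = a k / (1 + a k) *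
      ((if k = q then ℓ * (if p = l then ℓ * (1 - a l / (1 + a l)) * R.trace else 0) else 0) +
       (if k = l then ℓ * (if p = q then ℓ * (a p / (1 + a p)) * R.trace else 0) else 0)) := by
    rw [div_mul_eq_mul_div, eq_div_iff hk]
    linear_combination h1
  rw [h2]
  split_ifs <;> ring

variable [Fintype ι]

lemma trace_two_point_sum (hR : ∀ k, R * bd k = a k • (bd k * R))
    (hca : ∀ k l, bd k * b l + b l * bd k = if k = l then ℓ • 1 else 0)
    (ha : ∀ k, 1 + a k ≠ 0) (u v : ι → ℂ) :
    (R * ((∑ k, u k • bd k) * ∑ l, v l • b l)).trace =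
      ℓ * (∑ k, a k / (1 + a k) * (u k * v k)) * R.trace := by
  simp only [Finset.sum_mul, Finset.mul_sum, Matrix.trace_sum, smul_mul_assoc, mul_smul_comm,
    Matrix.trace_smul, smul_eq_mul, trace_two_point hR hca ha, mul_ite, mul_zero,
    Finset.sum_ite_eq', Finset.mem_univ, if_true]
  exact Finset.sum_congr rfl fun k _ => by ring

lemma trace_four_point_sum (hR : ∀ k, R * bd k = a k • (bd k * R))
    (hcc : ∀ k l, bd k * bd l + bd l * bd k = 0)
    (hca : ∀ k l, bd k * b l + b l * bd k = if k = l then ℓ • 1 else 0)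
    (ha : ∀ k, 1 + a k ≠ 0) (u v c d : ι → ℂ) :
    (R * (((∑ k, u k • bd k) * ∑ l, v l • b l) * ((∑ p, c p • bd p) * ∑ q, d q • b q))).trace =
      ℓ ^ 2 * ((∑ k, a k / (1 + a k) * (u k * d k)) * (∑ k, (1 - a k / (1 + a k)) * (v k * c k)) +
        (∑ k, a k / (1 + a k) * (u k * v k)) * (∑ k, a k / (1 + a k) * (c k * d k))) * R.trace := by
  have expand : ((∑ k, u k • bd k) * ∑ l, v l • b l) * ((∑ p, c p • bd p) * ∑ q, d q • b q) =
      ∑ k, ∑ l, ∑ p, ∑ q, (u k * v l * (c p * d q)) • (bd k * b l * (bd p * b q)) := by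
    rw [Finset.sum_mul_sum, Finset.sum_mul_sum, Finset.sum_mul]
    refine Finset.sum_congr rfl fun k _ => ?_
    rw [Finset.sum_mul]
    refine Finset.sum_congr rfl fun l _ => ?_
    simp only [Finset.mul_sum, smul_mul_smul_comm]
  have h1 : (R * ∑ k, ∑ l, ∑ p, ∑ q,
      (u k * v l * (c p * d q)) • (bd k * b l * (bd p * b q))).trace =
      ∑ k, ∑ l, ∑ p, ∑ q, (u k * v l * (c p * d q)) *
        (R * (bd k * b l * (bd p * b q))).trace := by
    simp only [Finset.mul_sum, Matrix.trace_sum, mul_smul_comm, Matrix.trace_smul, smul_eq_mul]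
  rw [expand, h1]
  simp only [trace_four_point hR hcc hca ha]
  simp only [← mul_assoc, ← Finset.sum_mul]
  congr 1
  simp only [mul_add, Finset.sum_add_distrib, mul_ite, mul_zero, Finset.sum_ite_eq',
    Finset.sum_ite_eq, Finset.mem_univ, if_true]
  congr 1
  · rw [Finset.sum_mul_sum, Finset.mul_sum]
    refine Finset.sum_congr rfl fun k _ => ?_
    rw [Finset.mul_sum]
    exact Finset.sum_congr rfl fun l _ => by ring
  · rw [Finset.sum_mul_sum, Finset.mul_sum]
    refine Finset.sum_congr rfl fun k _ => ?_
    rw [Finset.mul_sum, Finset.sum_eq_single_of_mem k (Finset.mem_univ k)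
      fun l _ hl => by simp [hl.symm]]
    refine Finset.sum_congr rfl fun p _ => ?_
    simp only [if_true, Finset.sum_ite_eq, Finset.mem_univ]
    ring

end Wick

/-! ### Fourier modes -/

section Modes

/-- The one-particle energy at phase factor `w`. -/
def modeEnergy (J h : ℝ) (w : ℂ) : ℂ := h + 2 * J * (w + w⁻¹)

/-- The phase of a mode at site `m` and time `t`. -/
def modePhase (J h t : ℝ) (m : ℕ) (w : ℂ) : ℂ :=
  w ^ m * Complex.exp (-(Complex.I * t) * modeEnergy J h w)

/-- The momenta compatible with the boundary phase `κ`: distinct unimodular `L`-th roots of `κ`. -/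
structure IsModeSystem {L : ℕ} (κ : ℂ) (w : ZMod L → ℂ) : Prop where
  sq : κ * κ = 1
  pow : ∀ k, w k ^ L = κ
  inj : Function.Injective w
  norm : ∀ k, ‖w k‖ = 1

lemma IsModeSystem.ne_zero {L : ℕ} {κ : ℂ} {w : ZMod L → ℂ} (hw : IsModeSystem κ w)
    (k : ZMod L) : w k ≠ 0 := by
  rw [← norm_ne_zero_iff, hw.norm]; exact one_ne_zero

lemma modePhase_ne_zero {L : ℕ} {κ : ℂ} {w : ZMod L → ℂ} (hw : IsModeSystem κ w)
    (J h t : ℝ) (m : ℕ) (k : ZMod L) :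
    modePhase J h t m (w k) ≠ 0 :=
  mul_ne_zero (pow_ne_zero _ (hw.ne_zero k)) (Complex.exp_ne_zero _)

variable {L : ℕ} [NeZero L]

lemma sum_zmod_val (f : ℕ → ℂ) : ∑ j : ZMod L, f j.val = ∑ i ∈ Finset.range L, f i := by
  obtain ⟨n, rfl⟩ : ∃ n, L = n + 1 := ⟨L - 1, (Nat.succ_pred (NeZero.ne L)).symm⟩
  exact Fin.sum_univ_eq_sum_range f (n + 1)

variable {κ : ℂ} {w : ZMod L → ℂ}

namespace IsModeSystem

lemma orthogonal (hw : IsModeSystem κ w) (k l : ZMod L) :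
    ∑ j : ZMod L, w k ^ j.val * (w l)⁻¹ ^ j.val = if k = l then (L : ℂ) else 0 := by
  simp only [← mul_pow]
  rw [sum_zmod_val fun i => (w k * (w l)⁻¹) ^ i]
  have hl := hw.ne_zero l
  split_ifs with h
  · subst h; simp [mul_inv_cancel₀ hl]
  · have h1 : w k * (w l)⁻¹ ≠ 1 := fun e => h (hw.inj (by field_simp at e; exact e))
    have hκ : κ ≠ 0 := fun e => by have := hw.sq; simp [e] at this
    rw [geom_sum_eq h1, mul_pow, inv_pow, hw.pow, hw.pow, mul_inv_cancel₀ hκ]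
    simp

/-- There are as many modes as sites, so the Fourier matrix is square and orthogonality of its rows,
a one-sided inverse, gives completeness. -/
lemma complete (hw : IsModeSystem κ w) (i j : ZMod L) :
    ∑ k : ZMod L, (w k)⁻¹ ^ i.val * w k ^ j.val = if i = j then (L : ℂ) else 0 := by
  have hL : (L : ℂ) ≠ 0 := Nat.cast_ne_zero.2 (NeZero.ne L)
  let U : Matrix (ZMod L) (ZMod L) ℂ := Matrix.of fun k j => (L : ℂ)⁻¹ * w k ^ j.val
  let V : Matrix (ZMod L) (ZMod L) ℂ := Matrix.of fun j l => (w l)⁻¹ ^ j.val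
  have h1 : U * V = 1 := by
    ext k l
    simp only [U, V, Matrix.mul_apply, Matrix.of_apply, mul_assoc, ← Finset.mul_sum,
      hw.orthogonal, Matrix.one_apply]
    split_ifs <;> simp [hL]
  have h1' : V * U = 1 := mul_eq_one_comm.1 h1
  have h2 := congrFun (congrFun h1' i) j
  simp only [U, V, Matrix.mul_apply, Matrix.of_apply, Matrix.one_apply, mul_left_comm _ (L : ℂ)⁻¹,
    ← Finset.mul_sum] at h2
  rw [inv_mul_eq_iff_eq_mul₀ hL] at h2
  rw [h2]
  split_ifs <;> simp

lemma cre_eq (hw : IsModeSystem κ w) (j : ZMod L) :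
    cre j = ∑ k, ((L : ℂ)⁻¹ * (w k)⁻¹ ^ j.val) • planeWave (w k) cre := by
  have hL : (L : ℂ) ≠ 0 := Nat.cast_ne_zero.2 (NeZero.ne L)
  simp only [planeWave, Finset.smul_sum, smul_smul]
  rw [Finset.sum_comm]
  simp only [← Finset.sum_smul, mul_assoc, ← Finset.mul_sum, hw.complete, mul_ite, mul_zero,
    inv_mul_cancel₀ hL, ite_smul, one_smul, zero_smul, Finset.sum_ite_eq, Finset.mem_univ, if_true]

lemma ann_eq (hw : IsModeSystem κ w) (j : ZMod L) :
    ann j = ∑ k, ((L : ℂ)⁻¹ * w k ^ j.val) • planeWave (w k)⁻¹ ann := by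
  have hL : (L : ℂ) ≠ 0 := Nat.cast_ne_zero.2 (NeZero.ne L)
  simp only [planeWave, Finset.smul_sum, smul_smul]
  rw [Finset.sum_comm]
  have e : ∀ i : ZMod L, ∑ k : ZMod L, (L : ℂ)⁻¹ * w k ^ j.val * (w k)⁻¹ ^ i.val =
      if i = j then 1 else 0 := fun i => by
    simp only [mul_assoc, mul_comm (w _ ^ j.val), ← Finset.mul_sum, hw.complete, mul_ite, mul_zero,
      inv_mul_cancel₀ hL]
  simp only [← Finset.sum_smul, e, ite_smul, one_smul, zero_smul, Finset.sum_ite_eq',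
    Finset.mem_univ, if_true]

lemma planeWave_cre_cre (k l : ZMod L) :
    (planeWave (w k) cre * planeWave (w l) cre : Op L) + planeWave (w l) cre * planeWave (w k) cre = 0 := by
  simp only [planeWave, Finset.sum_mul_sum, smul_mul_smul_comm]
  rw [Finset.sum_comm, ← Finset.sum_add_distrib]
  refine Finset.sum_eq_zero fun i _ => ?_
  rw [← Finset.sum_add_distrib]
  refine Finset.sum_eq_zero fun j _ => ?_
  rw [mul_comm (w l ^ _), ← smul_add, cre_cre, smul_zero]

lemma planeWave_cre_ann (hw : IsModeSystem κ w) (k l : ZMod L) :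
    (planeWave (w k) cre * planeWave (w l)⁻¹ ann : Op L) +
        planeWave (w l)⁻¹ ann * planeWave (w k) cre =
      if k = l then (L : ℂ) • (1 : Op L) else 0 := by
  have h1 : (planeWave (w k) cre * planeWave (w l)⁻¹ ann : Op L) +
      planeWave (w l)⁻¹ ann * planeWave (w k) cre =
      ∑ i : ZMod L, ∑ j : ZMod L, (w k ^ i.val * (w l)⁻¹ ^ j.val) • (if i = j then (1 : Op L) else 0) := by
    simp only [planeWave, Finset.sum_mul_sum, smul_mul_smul_comm]
    rw [Finset.sum_comm (s := Finset.univ) (t := Finset.univ) (f := fun i j : ZMod L =>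
      ((w l)⁻¹ ^ i.val * w k ^ j.val) • (ann i * cre j)), ← Finset.sum_add_distrib]
    refine Finset.sum_congr rfl fun i _ => ?_
    rw [← Finset.sum_add_distrib]
    refine Finset.sum_congr rfl fun j _ => ?_
    rw [mul_comm ((w l)⁻¹ ^ _), ← smul_add, cre_ann]
  rw [h1]
  simp only [smul_ite, smul_zero, Finset.sum_ite_eq, Finset.mem_univ, if_true]
  rw [← Finset.sum_smul, hw.orthogonal]
  split_ifs <;> simp

end IsModeSystem

/-! ### Traces in terms of the modes -/

/-- The density matrix `z ^ N e^{-β H}` of the twisted chain. -/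
def densityMatrix (L : ℕ) [NeZero L] (J h β : ℝ) (κ z : ℂ) : Op L :=
  fugacity z * NormedSpace.exp (-(β : ℂ) • twisted L J h κ)

lemma densityMatrix_mul_planeWave (hw : IsModeSystem κ w) (J h β : ℝ) (z : ℂ) (k : ZMod L) :
    densityMatrix L J h β κ z * planeWave (w k) cre =
      (z * Complex.exp (-β * modeEnergy J h (w k))) •
        (planeWave (w k) cre * densityMatrix L J h β κ z) := by
  have h1 : (fugacity z * planeWave (w k) cre : Op L) = z • (planeWave (w k) cre * fugacity z) := by
    simp only [planeWave, Finset.mul_sum, Finset.sum_mul, Finset.smul_sum, mul_smul_comm,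
      smul_mul_assoc, fugacity_mul_cre]
    exact Finset.sum_congr rfl fun j _ => smul_comm _ _ _
  rw [densityMatrix, mul_assoc,
    exp_smul_mul_of_commutator (twisted_mul_planeWave_cre J h (hw.pow k) hw.sq), mul_smul_comm,
    ← mul_assoc, h1, smul_mul_assoc, smul_smul, mul_assoc (planeWave _ _), modeEnergy, mul_comm z]

/-- The occupation number `z e^{-β ε} / (1 + z e^{-β ε})` of a mode. -/
def occupation (J h β : ℝ) (z w : ℂ) : ℂ :=
  z * Complex.exp (-β * modeEnergy J h w) / (1 + z * Complex.exp (-β * modeEnergy J h w))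

/-- The evolution only multiplies modes by phases, so the evolved number operator is again a product
of one creation and one annihilation sum, the form that Wick's theorem takes as input. -/
lemma twistedHeisenberg_cre_ann (hw : IsModeSystem κ w) (J h t : ℝ) (m : ZMod L) :
    twistedHeisenberg L J h κ t (cre m * ann m) =
      (∑ k, ((L : ℂ)⁻¹ * (modePhase J h t m.val (w k))⁻¹) • planeWave (w k) cre) *
        ∑ k, ((L : ℂ)⁻¹ * modePhase J h t m.val (w k)) • planeWave (w k)⁻¹ ann := by
  set E := NormedSpace.exp ((Complex.I * t) • twisted L J h κ) with hE
  have h1 : E * cre m =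
      (∑ k, ((L : ℂ)⁻¹ * (modePhase J h t m.val (w k))⁻¹) • planeWave (w k) cre) * E := by
    rw [hw.cre_eq m, Finset.mul_sum, Finset.sum_mul]
    refine Finset.sum_congr rfl fun k _ => ?_
    rw [mul_smul_comm, hE,
      exp_smul_mul_of_commutator (twisted_mul_planeWave_cre J h (hw.pow k) hw.sq), smul_smul,
      smul_mul_assoc, modePhase, modeEnergy, neg_mul, Complex.exp_neg, mul_inv, inv_inv, inv_pow,
      mul_assoc]
  have h2 : E * ann m =
      (∑ k, ((L : ℂ)⁻¹ * modePhase J h t m.val (w k)) • planeWave (w k)⁻¹ ann) * E := by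
    rw [hw.ann_eq m, Finset.mul_sum, Finset.sum_mul]
    refine Finset.sum_congr rfl fun k _ => ?_
    rw [mul_smul_comm, hE,
      exp_smul_mul_of_commutator (twisted_mul_planeWave_ann J h (hw.pow k) hw.sq), smul_smul,
      smul_mul_assoc, modePhase, modeEnergy, neg_mul, mul_neg, mul_assoc]
  rw [twistedHeisenberg, ← hE, ← mul_assoc, h1, mul_assoc _ E, h2, ← mul_assoc, mul_assoc _ E, hE,
    exp_smul_mul_exp_neg_smul, mul_one]

lemma trace_densityMatrix_number (hw : IsModeSystem κ w) (J h β : ℝ) {z : ℂ}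
    (hz : ∀ k, 1 + z * Complex.exp (-β * modeEnergy J h (w k)) ≠ 0) (j : ZMod L) :
    (densityMatrix L J h β κ z * (cre j * ann j)).trace =
      ((L : ℂ)⁻¹ * ∑ k, occupation J h β z (w k)) * (densityMatrix L J h β κ z).trace := by
  have hL : (L : ℂ) ≠ 0 := Nat.cast_ne_zero.2 (NeZero.ne L)
  rw [hw.cre_eq j, hw.ann_eq j,
    trace_two_point_sum (densityMatrix_mul_planeWave hw J h β z) hw.planeWave_cre_ann hz]
  congr 1
  rw [Finset.mul_sum, Finset.mul_sum]
  refine Finset.sum_congr rfl fun k _ => ?_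
  have := pow_ne_zero j.val (hw.ne_zero k)
  rw [occupation, inv_pow]
  field_simp

lemma trace_densityMatrix_number_heisenberg (hw : IsModeSystem κ w) (J h β t : ℝ) {z : ℂ}
    (hz : ∀ k, 1 + z * Complex.exp (-β * modeEnergy J h (w k)) ≠ 0) (m : ZMod L) :
    (densityMatrix L J h β κ z * twistedHeisenberg L J h κ t (cre m * ann m)).trace =
      ((L : ℂ)⁻¹ * ∑ k, occupation J h β z (w k)) * (densityMatrix L J h β κ z).trace := by
  have hL : (L : ℂ) ≠ 0 := Nat.cast_ne_zero.2 (NeZero.ne L)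
  rw [twistedHeisenberg_cre_ann hw,
    trace_two_point_sum (densityMatrix_mul_planeWave hw J h β z) hw.planeWave_cre_ann hz]
  congr 1
  rw [Finset.mul_sum, Finset.mul_sum]
  refine Finset.sum_congr rfl fun k _ => ?_
  have := modePhase_ne_zero hw J h t m.val k
  rw [occupation]
  field_simp

lemma trace_densityMatrix_number_number (hw : IsModeSystem κ w) (J h β t : ℝ) {z : ℂ}
    (hz : ∀ k, 1 + z * Complex.exp (-β * modeEnergy J h (w k)) ≠ 0) (m : ZMod L) :
    (densityMatrix L J h β κ z *
      (cre 0 * ann 0 * twistedHeisenberg L J h κ t (cre m * ann m))).trace =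
      (((L : ℂ)⁻¹ * ∑ k, occupation J h β z (w k) * modePhase J h t m.val (w k)) *
        ((L : ℂ)⁻¹ * ∑ k, (1 - occupation J h β z (w k)) * (modePhase J h t m.val (w k))⁻¹) +
        ((L : ℂ)⁻¹ * ∑ k, occupation J h β z (w k)) ^ 2) * (densityMatrix L J h β κ z).trace := by
  have hL : (L : ℂ) ≠ 0 := Nat.cast_ne_zero.2 (NeZero.ne L)
  rw [twistedHeisenberg_cre_ann hw, hw.cre_eq 0, hw.ann_eq 0,
    trace_four_point_sum (densityMatrix_mul_planeWave hw J h β z)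
      (IsModeSystem.planeWave_cre_cre (w := w)) hw.planeWave_cre_ann hz]
  congr 1
  have e : ∀ f x : ZMod L → ℂ, ∑ k, f k * ((L : ℂ)⁻¹ * ((L : ℂ)⁻¹ * x k)) =
      (L : ℂ)⁻¹ * ((L : ℂ)⁻¹ * ∑ k, f k * x k) := fun f x => by
    simp only [Finset.mul_sum]; exact Finset.sum_congr rfl fun k _ => by ring
  have e1 : ∀ f x : ZMod L → ℂ, (∀ k, x k ≠ 0) →
      ∑ k, f k * ((L : ℂ)⁻¹ * (x k)⁻¹ * ((L : ℂ)⁻¹ * x k)) =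
      (L : ℂ)⁻¹ * ((L : ℂ)⁻¹ * ∑ k, f k) := fun f x hx => by
    simp only [Finset.mul_sum]
    refine Finset.sum_congr rfl fun k _ => ?_
    have := hx k
    field_simp
  rw [e1 _ _ (modePhase_ne_zero hw J h t m.val)]
  have hocc : ∀ k, z * Complex.exp (-β * modeEnergy J h (w k)) /
      (1 + z * Complex.exp (-β * modeEnergy J h (w k))) = occupation J h β z (w k) := fun _ => rfl
  simp only [ZMod.val_zero, pow_zero, mul_one, e, hocc]
  rw [show ∀ f : ZMod L → ℂ, ∑ k, f k * ((L : ℂ)⁻¹ * (L : ℂ)⁻¹) =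
    (L : ℂ)⁻¹ * ((L : ℂ)⁻¹ * ∑ k, f k) from fun f => by rw [← Finset.sum_mul]; ring]
  field_simp

end Modes

/-! ### The partition function of the twisted chain -/

section Partition

/-- Equal logarithmic derivatives force a constant quotient. -/
lemma eq_C_mul_of_derivative_mul_eq {f g : Polynomial ℂ}
    (h : f.derivative * g = f * g.derivative) (hg : g.eval 0 = 1) :
    f = Polynomial.C (f.eval 0) * g := by
  set s := f - Polynomial.C (f.eval 0) * g with hs
  have h1 : s.derivative * g = s * g.derivative := by
    simp only [hs, Polynomial.derivative_sub, Polynomial.derivative_C_mul]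
    linear_combination h
  have h0 : s.coeff 0 = 0 := by
    rw [Polynomial.coeff_zero_eq_eval_zero]; simp [hs, hg]
  have hcoeff : ∀ n, s.coeff n = 0 := by
    intro n
    induction n using Nat.strong_induction_on with
    | _ n ih =>
      rcases n with _ | n
      · exact h0
      · have h2 := congrArg (fun p => Polynomial.coeff p n) h1
        simp only [Polynomial.coeff_mul] at h2
        -- With all coefficients of `s` up to degree `n` zero, degree `n` of `s' g = s g'` reduces
        -- to `(n + 1) sₙ₊₁ g(0) = 0`.
        rw [Finset.sum_eq_single_of_mem (n, 0) (by simp), Finset.sum_eq_zero] at h2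
        · rw [Polynomial.coeff_derivative, Polynomial.coeff_zero_eq_eval_zero, hg] at h2
          have : ((n : ℂ) + 1) ≠ 0 := Nat.cast_add_one_ne_zero n
          simpa [this] using h2
        · intro x hx
          rw [ih x.1 (by have := Finset.HasAntidiagonal.mem_antidiagonal.1 hx; omega), zero_mul]
        · intro x hx hne
          have hx' := Finset.HasAntidiagonal.mem_antidiagonal.1 hx
          have : x.1 + 1 < n + 1 := by
            rcases x with ⟨a, b⟩
            simp only at hx' ⊢
            rcases Nat.eq_zero_or_pos b with hb | hb
            · subst hb; exact absurd (by simp at hx'; simp [hx']) hne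
            · omega
          rw [Polynomial.coeff_derivative, ih _ this, zero_mul, zero_mul]
  exact sub_eq_zero.1 (Polynomial.ext fun n => by rw [← hs, hcoeff n, Polynomial.coeff_zero])

variable {L : ℕ} [NeZero L]

lemma cre_mul_ann_eq_diagonal (j : ZMod L) :
    (cre j * ann j : Op L) = Matrix.diagonal fun s => ((s j).val : ℂ) := by
  rw [cre, ann, jordanWigner_mul_self]
  ext s s'
  have : ∀ k : ZMod L, (if k = j then lowerSpin * raiseSpin else 1) (s k) (s' k) =
      if s k = s' k then (if k = j then ((s k).val : ℂ) else 1) else 0 := by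
    intro k
    by_cases hk : k = j
    · simp only [hk, if_true]
      generalize s j = a
      generalize s' j = b
      fin_cases a <;> fin_cases b <;> simp [lowerSpin, raiseSpin]
    · simp [hk, Matrix.one_apply]
  simp only [site, Matrix.of_apply, this, Matrix.diagonal_apply]
  rw [Finset.prod_ite_zero]
  simp [funext_iff]

lemma densityMatrix_apply (J h β : ℝ) (κ z : ℂ) (s s' : Config L) :
    densityMatrix L J h β κ z s s' = z ^ (∑ k, (s k).val) *
      NormedSpace.exp (-(β : ℂ) • twisted L J h κ) s s' := by
  rw [densityMatrix, fugacity_eq_diagonal, Matrix.diagonal_mul]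

lemma twistedTrace_eq_sum (J h β : ℝ) (κ z : ℂ) (A : Op L) :
    twistedTrace L J h β κ z A = ∑ s : Config L, z ^ (∑ k, (s k).val) *
      (NormedSpace.exp (-(β : ℂ) • twisted L J h κ) * A) s s := by
  simp only [twistedTrace, mul_assoc, fugacity_eq_diagonal, Matrix.trace, Matrix.diag_apply,
    Matrix.diagonal_mul]

lemma continuous_twistedTrace (J h β : ℝ) (κ : ℂ) (A : Op L) :
    Continuous fun z => twistedTrace L J h β κ z A := by
  simp only [twistedTrace_eq_sum]; fun_prop

/-- At zero fugacity only the vacuum, all spins up, contributes; it is annihilated by every `ann j`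
and has energy `-h L / 2`. -/
lemma twistedTrace_zero_one (J h β : ℝ) (κ : ℂ) :
    twistedTrace L J h β κ 0 1 = Real.exp (β * h * L / 2) := by
  let V : Op L := Matrix.single 0 0 1
  have hann : ∀ j : ZMod L, ann j * V = 0 := by
    intro j
    ext s s'
    by_cases hs' : s' = 0
    · subst hs'
      simp only [V, Matrix.mul_single_apply_same, mul_one, Matrix.zero_apply]
      refine Finset.prod_eq_zero (Finset.mem_univ j) ?_
      simp only [lt_irrefl, if_false, if_true, Pi.zero_apply]
      generalize s j = a
      fin_cases a <;> simp [raiseSpin]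
    · simp [V, Matrix.mul_single_apply_of_ne, hs']
  have hV : twisted L J h κ * V = V * ((-(h * L / 2) : ℂ) • 1) := by
    simp only [twisted, sub_mul, add_mul, smul_mul_assoc, Finset.sum_mul, mul_assoc, hann, mul_zero,
      add_zero, smul_zero, Finset.sum_const_zero, one_mul, zero_sub, neg_smul]
    rw [mul_neg, mul_smul_comm, mul_one]
  have hE : NormedSpace.exp (-(β : ℂ) • twisted L J h κ) * V =
      V * (Complex.exp (β * h * L / 2) • 1) := by
    rw [← exp_smul_one]
    refine exp_mul_eq_mul_exp ?_
    rw [smul_mul_assoc, hV, ← mul_smul_comm, smul_smul]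
    congr 2; ring
  have h00 : NormedSpace.exp (-(β : ℂ) • twisted L J h κ) 0 0 = Complex.exp (β * h * L / 2) := by
    have := congrFun (congrFun hE 0) 0
    simpa [V] using this
  rw [twistedTrace_eq_sum, Finset.sum_eq_single_of_mem 0 (Finset.mem_univ _)]
  · rw [mul_one, h00]; simp
  · intro s _ hs
    have : ∑ k, (s k).val ≠ 0 := by
      intro e
      apply hs
      funext k
      exact Fin.ext ((Finset.sum_eq_zero_iff.1 e) k (Finset.mem_univ k))
    rw [zero_pow this, zero_mul]

/-- The Boltzmann weight of a mode. -/
def boltzmann (J h β : ℝ) (w : ℂ) : ℂ := Complex.exp (-β * modeEnergy J h w)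

variable {κ : ℂ} {w : ZMod L → ℂ}

/-- `z d/dz` of the logarithm of the trace is the mean particle number, which the two-point function
already gives as a sum over modes. The claimed product has the same logarithmic derivative, and the
vacuum fixes the constant at `z = 0`. No Fock basis of modes is needed. -/
lemma twistedTrace_one (hw : IsModeSystem κ w) (J h β : ℝ) (z : ℂ) :
    twistedTrace L J h β κ z 1 =
      Real.exp (β * h * L / 2) * ∏ k, (1 + z * boltzmann J h β (w k)) := by
  let M := NormedSpace.exp (-(β : ℂ) • twisted L J h κ)
  let T : Polynomial ℂ := ∑ s : Config L, Polynomial.C (M s s) * Polynomial.X ^ (∑ k, (s k).val)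
  let Q : Polynomial ℂ := ∏ k, (1 + Polynomial.C (boltzmann J h β (w k)) * Polynomial.X)
  have hT : ∀ z, T.eval z = twistedTrace L J h β κ z 1 := fun z => by
    simp only [T, M, twistedTrace_eq_sum, Polynomial.eval_finsetSum, Polynomial.eval_mul,
      Polynomial.eval_C, Polynomial.eval_pow, Polynomial.eval_X, mul_one, mul_comm]
  have hQ : ∀ z, Q.eval z = ∏ k, (1 + z * boltzmann J h β (w k)) := fun z => by
    simp only [Q, Polynomial.eval_prod, Polynomial.eval_add, Polynomial.eval_one,
      Polynomial.eval_mul, Polynomial.eval_C, Polynomial.eval_X, mul_comm]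
  have hQ0 : Q.eval 0 = 1 := by simp [hQ]
  have hQne : Q ≠ 0 := fun e => by simp [e] at hQ0
  have hTd : ∀ z, z * T.derivative.eval z =
      ∑ j : ZMod L, (densityMatrix L J h β κ z * (cre j * ann j)).trace := fun z => by
    simp only [T, cre_mul_ann_eq_diagonal, Matrix.trace, Matrix.diag_apply, Matrix.mul_diagonal,
      densityMatrix_apply, Polynomial.derivative_sum, Polynomial.eval_finsetSum,
      Polynomial.derivative_C_mul_X_pow, Polynomial.eval_mul, Polynomial.eval_C,
      Polynomial.eval_pow, Polynomial.eval_X]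
    rw [Finset.sum_comm, Finset.mul_sum]
    refine Finset.sum_congr rfl fun s _ => ?_
    rw [← Finset.mul_sum, ← Nat.cast_sum]
    rcases Nat.eq_zero_or_pos (∑ k, (s k).val) with h0 | h0
    · simp [h0]
    · obtain ⟨n, hn⟩ := Nat.exists_eq_succ_of_ne_zero h0.ne'
      rw [hn]
      simp only [Nat.succ_eq_add_one, Nat.add_sub_cancel, M]
      ring
  have hW : Polynomial.X * (T.derivative * Q) = Polynomial.X * (T * Q.derivative) := by
    -- The two-point function is available only where no factor `1 + z y` vanishes, that is off the
    -- roots of `Q`; this cofinite set suffices for a polynomial identity.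
    refine Polynomial.eq_of_infinite_eval_eq _ _ ?_
    refine Set.Infinite.mono (s := {z | Q.IsRoot z}ᶜ) ?_
      (Polynomial.finite_setOfPred_isRoot hQne).infinite_compl
    · intro z hz
      have hz' : Q.eval z ≠ 0 := hz
      have hk : ∀ k, 1 + z * boltzmann J h β (w k) ≠ 0 := fun k e => by
        apply hz'; rw [hQ]; exact Finset.prod_eq_zero (Finset.mem_univ k) e
      have hL : (L : ℂ) ≠ 0 := Nat.cast_ne_zero.2 (NeZero.ne L)
      have h1 : z * T.derivative.eval z = (∑ k, occupation J h β z (w k)) * T.eval z := by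
        rw [hTd, Finset.sum_congr rfl fun j _ => trace_densityMatrix_number hw J h β hk j,
          Finset.sum_const, Finset.card_univ, ZMod.card, nsmul_eq_mul, hT, twistedTrace, mul_one,
          densityMatrix]
        field_simp
      have h2 : z * Q.derivative.eval z = (∑ k, occupation J h β z (w k)) * Q.eval z := by
        simp only [Q, Polynomial.derivative_prod_finset, Polynomial.eval_finsetSum, Finset.mul_sum,
          Finset.sum_mul, Polynomial.eval_mul]
        refine Finset.sum_congr rfl fun k _ => ?_
        rw [Polynomial.eval_prod, Polynomial.eval_prod, ← Finset.mul_prod_erase _ _ (Finset.mem_univ k)]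
        have := hk k
        have hocc : occupation J h β z (w k) =
          z * boltzmann J h β (w k) / (1 + z * boltzmann J h β (w k)) := rfl
        rw [hocc]
        simp
        field_simp
      simp only [Set.mem_ofPred_eq, Polynomial.eval_mul, Polynomial.eval_X]
      linear_combination Q.eval z * h1 - T.eval z * h2
  have h3 := eq_C_mul_of_derivative_mul_eq (mul_left_cancel₀ Polynomial.X_ne_zero hW) hQ0
  rw [← hT, h3, Polynomial.eval_mul, Polynomial.eval_C, hQ, hT, twistedTrace_zero_one]

/-! ### Traces of spin observables -/

lemma twistedHeisenberg_one_add_smul (J h t : ℝ) (κ c : ℂ) (A : Op L) :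
    twistedHeisenberg L J h κ t (1 + c • A) = 1 + c • twistedHeisenberg L J h κ t A := by
  rw [twistedHeisenberg, mul_add, add_mul, mul_one, exp_smul_mul_exp_neg_smul, twistedHeisenberg,
    mul_smul_comm, smul_mul_assoc]

lemma twistedTrace_add_smul (J h β : ℝ) (κ z c : ℂ) (A B : Op L) :
    twistedTrace L J h β κ z (A + c • B) =
      twistedTrace L J h β κ z A + c * twistedTrace L J h β κ z B := by
  rw [twistedTrace, mul_add, mul_smul_comm, Matrix.trace_add, Matrix.trace_smul, smul_eq_mul]
  rfl

/-- The mean occupation number. -/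
def meanOccupation {L : ℕ} [NeZero L] (J h β : ℝ) (z : ℂ) (w : ZMod L → ℂ) : ℂ :=
  (L : ℂ)⁻¹ * ∑ k, occupation J h β z (w k)

/-- The propagator of particles. -/
def particlePropagator {L : ℕ} [NeZero L] (J h β t : ℝ) (m : ℕ) (z : ℂ) (w : ZMod L → ℂ) : ℂ :=
  (L : ℂ)⁻¹ * ∑ k, occupation J h β z (w k) * modePhase J h t m (w k)

/-- The propagator of holes. -/
def holePropagator {L : ℕ} [NeZero L] (J h β t : ℝ) (m : ℕ) (z : ℂ) (w : ZMod L → ℂ) : ℂ :=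
  (L : ℂ)⁻¹ * ∑ k, (1 - occupation J h β z (w k)) * (modePhase J h t m (w k))⁻¹

lemma twistedTrace_pauliZ (hw : IsModeSystem κ w) (J h β : ℝ) {z : ℂ}
    (hz : ∀ k, 1 + z * boltzmann J h β (w k) ≠ 0) (j : ZMod L) :
    twistedTrace L J h β κ z (site L j pauliZ) =
      (1 - 2 * meanOccupation J h β z w) * twistedTrace L J h β κ z 1 := by
  have h1 : twistedTrace L J h β κ z (cre j * ann j) =
      meanOccupation J h β z w * twistedTrace L J h β κ z 1 := by
    rw [twistedTrace, ← densityMatrix, trace_densityMatrix_number hw J h β hz, twistedTrace,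
      mul_one, densityMatrix, meanOccupation]
  rw [site_pauliZ, twistedTrace_add_smul, h1]
  ring

lemma twistedTrace_pauliZ_pauliZ (hw : IsModeSystem κ w) (J h β t : ℝ) {z : ℂ}
    (hz : ∀ k, 1 + z * boltzmann J h β (w k) ≠ 0) (m : ZMod L) :
    twistedTrace L J h β κ z
        (site L 0 pauliZ * twistedHeisenberg L J h κ t (site L m pauliZ)) =
      ((1 - 2 * meanOccupation J h β z w) ^ 2 + 4 * (particlePropagator J h β t m.val z w *
        holePropagator J h β t m.val z w)) * twistedTrace L J h β κ z 1 := by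
  have h1 : twistedTrace L J h β κ z (cre 0 * ann 0) =
      meanOccupation J h β z w * twistedTrace L J h β κ z 1 := by
    rw [twistedTrace, ← densityMatrix, trace_densityMatrix_number hw J h β hz, twistedTrace,
      mul_one, densityMatrix, meanOccupation]
  have h2 : twistedTrace L J h β κ z (twistedHeisenberg L J h κ t (cre m * ann m)) =
      meanOccupation J h β z w * twistedTrace L J h β κ z 1 := by
    rw [twistedTrace, ← densityMatrix, trace_densityMatrix_number_heisenberg hw J h β t hz,
      twistedTrace, mul_one, densityMatrix, meanOccupation]
  have h3 : twistedTrace L J h β κ z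
      (cre 0 * ann 0 * twistedHeisenberg L J h κ t (cre m * ann m)) =
      (particlePropagator J h β t m.val z w * holePropagator J h β t m.val z w +
        meanOccupation J h β z w ^ 2) * twistedTrace L J h β κ z 1 := by
    rw [twistedTrace, ← densityMatrix, trace_densityMatrix_number_number hw J h β t hz,
      twistedTrace, mul_one, densityMatrix, meanOccupation, particlePropagator, holePropagator]
  have h4 : (1 + (-2 : ℂ) • (cre 0 * ann 0)) *
      (1 + (-2 : ℂ) • twistedHeisenberg L J h κ t (cre m * ann m)) =
      1 + (-2 : ℂ) • (cre 0 * ann 0) + (-2 : ℂ) • twistedHeisenberg L J h κ t (cre m * ann m) +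
        (4 : ℂ) • (cre 0 * ann 0 * twistedHeisenberg L J h κ t (cre m * ann m)) := by
    rw [mul_add, add_mul, add_mul, smul_mul_smul_comm]
    norm_num
    abel
  rw [site_pauliZ, site_pauliZ, twistedHeisenberg_one_add_smul, h4, twistedTrace_add_smul,
    twistedTrace_add_smul, twistedTrace_add_smul, h1, h2, h3]
  ring

end Partition

/-! ### Bounds for the contribution of the fermion parity -/

section ParityBound

variable {ι : Type*} {y : ι → ℝ} {x : ι → ℂ} {z : ℂ}

/-- The source of exponential smallness: at `z = -1` each mode loses a factor `r` against `z = 1`.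
-/
lemma norm_prod_one_sub_le {r : ℝ} (hr : ∀ k, |1 - y k| ≤ r * (1 + y k))
    (s : Finset ι) :
    ‖∏ j ∈ s, (1 + (-1) * (y j : ℂ))‖ ≤ r ^ s.card * ∏ j ∈ s, (1 + y j) := by
  rw [norm_prod, ← Finset.prod_const, ← Finset.prod_mul_distrib]
  refine Finset.prod_le_prod (fun _ _ => norm_nonneg _) fun j _ => ?_
  refine le_trans (le_of_eq ?_) (hr j)
  rw [neg_one_mul, ← sub_eq_add_neg, ← Complex.ofReal_one, ← Complex.ofReal_sub, Complex.norm_real,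
    Real.norm_eq_abs]

/-- All exceptional values of `z` are real because the weights are, so `-1` is approached from the
upper half plane. -/
lemma norm_neg_one_le_of_generic {F B : ℂ → ℝ} (hF : Continuous F) (hB : Continuous B)
    (h : ∀ z, (∀ k, 1 + z * (y k : ℂ) ≠ 0) → F z ≤ B z) (hy : ∀ k, 0 < y k) : F (-1) ≤ B (-1) := by
  have hs : Tendsto (fun n : ℕ => (-1 : ℂ) + ((1 / ((n : ℝ) + 1) : ℝ) : ℂ) * Complex.I) atTop
      (𝓝 (-1)) := by
    have h1 : Tendsto (fun n : ℕ => ((1 / ((n : ℝ) + 1) : ℝ) : ℂ)) atTop (𝓝 ((0 : ℝ) : ℂ)) :=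
      (Complex.continuous_ofReal.tendsto 0).comp tendsto_one_div_add_atTop_nhds_zero_nat
    simpa using (h1.mul_const Complex.I).const_add (-1 : ℂ)
  refine le_of_tendsto_of_tendsto' ((hF.tendsto _).comp hs) ((hB.tendsto _).comp hs) fun n => ?_
  refine h _ fun k e => ?_
  have him := congrArg Complex.im e
  simp at him
  rcases him with (him | him) | him
  · exact absurd him (Nat.cast_add_one_ne_zero n)
  · exact absurd him (Nat.cast_add_one_ne_zero n)
  · exact absurd him (hy k).ne'

variable [DecidableEq ι]

/-- The pole of one occupation number is cancelled by its own factor of the partition function,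
leaving an expression continuous at `z = -1`. -/
lemma prod_mul_div_one_add (hz : ∀ k, 1 + z * (y k : ℂ) ≠ 0) (s : Finset ι) {k : ι} (hk : k ∈ s) :
    (∏ j ∈ s, (1 + z * (y j : ℂ))) * (z * y k / (1 + z * y k)) =
      z * y k * ∏ j ∈ s.erase k, (1 + z * (y j : ℂ)) := by
  rw [← Finset.mul_prod_erase _ _ hk]
  have := hz k
  field_simp

lemma norm_mul_norm_prod_erase_le {r : ℝ} (hy : ∀ k, 0 < y k) (hr : ∀ k, |1 - y k| ≤ r * (1 + y k))
    (s : Finset ι) {k : ι} (hk : k ∈ s) :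
    ‖(-1 : ℂ) * y k‖ * ‖∏ j ∈ s.erase k, (1 + (-1) * (y j : ℂ))‖ ≤
      r ^ (s.card - 1) * ∏ j ∈ s, (1 + y j) := by
  have h1 : ‖(-1 : ℂ) * y k‖ ≤ 1 + y k := by
    rw [neg_one_mul, norm_neg, Complex.norm_real, Real.norm_eq_abs, abs_of_pos (hy k)]; linarith
  have h2 := norm_prod_one_sub_le hr (s.erase k)
  rw [Finset.card_erase_of_mem hk] at h2
  rw [← Finset.mul_prod_erase s _ hk, mul_left_comm]
  exact mul_le_mul h1 h2 (norm_nonneg _) (by have := hy k; linarith)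

variable [Fintype ι]

/-- Bound for a one-particle expectation value times the partition function. -/
def singleBound (y : ι → ℝ) (z : ℂ) : ℝ :=
  (Fintype.card ι : ℝ)⁻¹ * ∑ k, ‖z * y k‖ * ‖∏ j ∈ Finset.univ.erase k, (1 + z * (y j : ℂ))‖

/-- Bound for a connected two-particle expectation value times the partition function. -/
def pairBound (y : ι → ℝ) (z : ℂ) : ℝ :=
  (Fintype.card ι : ℝ)⁻¹ * ∑ k, (Fintype.card ι : ℝ)⁻¹ * ∑ l ∈ Finset.univ.erase k,
    ‖z * y k‖ * ‖z * y l‖ * ‖∏ j ∈ (Finset.univ.erase k).erase l, (1 + z * (y j : ℂ))‖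

lemma continuous_singleBound (y : ι → ℝ) : Continuous (singleBound y) := by
  unfold singleBound; fun_prop

lemma continuous_pairBound (y : ι → ℝ) : Continuous (pairBound y) := by
  unfold pairBound; fun_prop

lemma norm_prod_mul_mean_le (hz : ∀ k, 1 + z * (y k : ℂ) ≠ 0) (hx : ∀ k, ‖x k‖ = 1) :
    ‖(∏ j, (1 + z * (y j : ℂ))) *
      ((Fintype.card ι : ℂ)⁻¹ * ∑ k, z * y k / (1 + z * y k) * x k)‖ ≤ singleBound y z := by
  rw [mul_left_comm, norm_mul, norm_inv, Complex.norm_natCast, singleBound, Finset.mul_sum]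
  refine mul_le_mul_of_nonneg_left ((norm_sum_le _ _).trans (Finset.sum_le_sum fun k _ => ?_))
    (by positivity)
  rw [← mul_assoc, prod_mul_div_one_add hz _ (Finset.mem_univ k), norm_mul, norm_mul, hx, mul_one]

/-- Separately the two products contain squared occupation numbers, hence double poles that the
partition function cannot absorb. In the difference the pair `(k, l)` carries the factor `1 - x k /
x l`, which vanishes for `k = l` (Pauli exclusion) and is at most `2` in norm otherwise. -/
lemma norm_prod_mul_pair_le (hz : ∀ k, 1 + z * (y k : ℂ) ≠ 0) (hx : ∀ k, ‖x k‖ = 1) :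
    ‖(∏ j, (1 + z * (y j : ℂ))) *
      (((Fintype.card ι : ℂ)⁻¹ * ∑ k, z * y k / (1 + z * y k)) ^ 2 -
        ((Fintype.card ι : ℂ)⁻¹ * ∑ k, z * y k / (1 + z * y k) * x k) *
        ((Fintype.card ι : ℂ)⁻¹ * ∑ k, z * y k / (1 + z * y k) * (x k)⁻¹))‖ ≤
      2 * pairBound y z := by
  have hx0 : ∀ k, x k ≠ 0 := fun k => by rw [← norm_ne_zero_iff, hx]; exact one_ne_zero
  have e : (∏ j, (1 + z * (y j : ℂ))) *
      (((Fintype.card ι : ℂ)⁻¹ * ∑ k, z * y k / (1 + z * y k)) ^ 2 -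
        ((Fintype.card ι : ℂ)⁻¹ * ∑ k, z * y k / (1 + z * y k) * x k) *
        ((Fintype.card ι : ℂ)⁻¹ * ∑ k, z * y k / (1 + z * y k) * (x k)⁻¹)) =
      (Fintype.card ι : ℂ)⁻¹ * ∑ k, (Fintype.card ι : ℂ)⁻¹ * ∑ l ∈ Finset.univ.erase k,
        (z * y k) * (z * y l) * (∏ j ∈ (Finset.univ.erase k).erase l, (1 + z * (y j : ℂ))) *
          (1 - x k * (x l)⁻¹) := by
    have e1 : ∀ k, ∑ l ∈ Finset.univ.erase k, (z * y k) * (z * y l) *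
        (∏ j ∈ (Finset.univ.erase k).erase l, (1 + z * (y j : ℂ))) * (1 - x k * (x l)⁻¹) =
        ∑ l, (∏ j, (1 + z * (y j : ℂ))) * (z * y k / (1 + z * y k)) *
          (z * y l / (1 + z * y l)) * (1 - x k * (x l)⁻¹) := by
      intro k
      rw [← Finset.add_sum_erase _ _ (Finset.mem_univ k), mul_inv_cancel₀ (hx0 k), sub_self,
        mul_zero, zero_add]
      refine Finset.sum_congr rfl fun l hl => ?_
      rw [prod_mul_div_one_add hz _ (Finset.mem_univ k), mul_assoc (z * y k : ℂ) (∏ j ∈ _, _),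
        prod_mul_div_one_add hz _ hl]
      ring
    simp only [e1]
    rw [sq, mul_mul_mul_comm, mul_mul_mul_comm _ _ _ (∑ k, _ * (x k)⁻¹), Finset.sum_mul_sum,
      Finset.sum_mul_sum, ← mul_sub, ← Finset.sum_sub_distrib, ← Finset.mul_sum]
    rw [mul_left_comm, mul_assoc, Finset.mul_sum]
    congr 2
    refine Finset.sum_congr rfl fun k _ => ?_
    rw [← Finset.sum_sub_distrib, Finset.mul_sum]
    refine Finset.sum_congr rfl fun l _ => ?_
    ring
  rw [e, norm_mul, norm_inv, Complex.norm_natCast, pairBound, mul_left_comm]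
  refine mul_le_mul_of_nonneg_left ?_ (by positivity)
  rw [Finset.mul_sum]
  refine (norm_sum_le _ _).trans (Finset.sum_le_sum fun k _ => ?_)
  rw [norm_mul, norm_inv, Complex.norm_natCast, mul_left_comm 2]
  refine mul_le_mul_of_nonneg_left ?_ (by positivity)
  rw [Finset.mul_sum]
  refine (norm_sum_le _ _).trans (Finset.sum_le_sum fun l _ => ?_)
  have h2 : ‖1 - x k * (x l)⁻¹‖ ≤ 2 := by
    refine (norm_sub_le _ _).trans ?_
    rw [norm_mul, norm_inv, hx, hx]; norm_num
  rw [norm_mul, norm_mul, norm_mul, mul_comm 2]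
  exact mul_le_mul_of_nonneg_left h2 (by positivity)

/-- The bound for the two-point function of `σᶻ` times the partition function. -/
lemma norm_prod_mul_correlation_le (hz : ∀ k, 1 + z * (y k : ℂ) ≠ 0) (hx : ∀ k, ‖x k‖ = 1) :
    ‖(∏ j, (1 + z * (y j : ℂ))) *
      ((1 - 2 * ((Fintype.card ι : ℂ)⁻¹ * ∑ k, z * y k / (1 + z * y k))) ^ 2 +
        4 * (((Fintype.card ι : ℂ)⁻¹ * ∑ k, z * y k / (1 + z * y k) * x k) *
        ((Fintype.card ι : ℂ)⁻¹ * ∑ k, (1 - z * y k / (1 + z * y k)) * (x k)⁻¹)))‖ ≤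
      ‖∏ j, (1 + z * (y j : ℂ))‖ + 8 * singleBound y z + 8 * pairBound y z := by
  set D := ∏ j, (1 + z * (y j : ℂ)) with hD
  set g := (Fintype.card ι : ℂ)⁻¹ * ∑ k, z * y k / (1 + z * y k) with hg
  set u := (Fintype.card ι : ℂ)⁻¹ * ∑ k, z * y k / (1 + z * y k) * x k with hu
  set v := (Fintype.card ι : ℂ)⁻¹ * ∑ k, z * y k / (1 + z * y k) * (x k)⁻¹ with hv
  set c := (Fintype.card ι : ℂ)⁻¹ * ∑ k, (x k)⁻¹ with hc
  have h1 : (Fintype.card ι : ℂ)⁻¹ * ∑ k, (1 - z * y k / (1 + z * y k)) * (x k)⁻¹ = c - v := by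
    simp only [hc, hv, sub_mul, one_mul, Finset.sum_sub_distrib, mul_sub]
  have hcn : ‖c‖ ≤ 1 := by
    rw [hc, norm_mul, norm_inv, Complex.norm_natCast]
    have : ‖∑ k, (x k)⁻¹‖ ≤ Fintype.card ι := by
      refine (norm_sum_le _ _).trans ?_
      simp [hx]
    rcases Nat.eq_zero_or_pos (Fintype.card ι) with h0 | h0
    · simp [h0]
    · rw [inv_mul_le_iff₀ (by exact_mod_cast h0), mul_one]; exact this
  have hgb : ‖D * g‖ ≤ singleBound y z := by
    have := norm_prod_mul_mean_le (x := fun _ => 1) hz (by simp)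
    simpa only [mul_one] using this
  have hub : ‖D * u‖ ≤ singleBound y z := norm_prod_mul_mean_le hz hx
  have hp : ‖D * (g ^ 2 - u * v)‖ ≤ 2 * pairBound y z := norm_prod_mul_pair_le hz hx
  rw [h1]
  -- The terms `g ^ 2` and `u * v` must stay together, since only their difference has simple poles.
  have e : D * ((1 - 2 * g) ^ 2 + 4 * (u * (c - v))) =
      D + (-4) * (D * g) + 4 * (D * u * c) + 4 * (D * (g ^ 2 - u * v)) := by ring
  rw [e]
  have hn4 : ‖(4 : ℂ)‖ = 4 := by norm_num
  have hn4' : ‖(-4 : ℂ)‖ = 4 := by rw [norm_neg, hn4]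
  refine (norm_add_le _ _).trans ?_
  refine (add_le_add_left ((norm_add_le _ _).trans
    (add_le_add_left (norm_add_le _ _) _)) _).trans ?_
  rw [norm_mul (-4), norm_mul 4, norm_mul 4, norm_mul (D * u), hn4, hn4']
  have : ‖D * u‖ * ‖c‖ ≤ singleBound y z * 1 := mul_le_mul hub hcn (norm_nonneg _)
    ((norm_nonneg _).trans hub)
  linarith

lemma norm_prod_mul_magnetization_le (hz : ∀ k, 1 + z * (y k : ℂ) ≠ 0) :
    ‖(∏ j, (1 + z * (y j : ℂ))) *
      (1 - 2 * ((Fintype.card ι : ℂ)⁻¹ * ∑ k, z * y k / (1 + z * y k)))‖ ≤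
      ‖∏ j, (1 + z * (y j : ℂ))‖ + 2 * singleBound y z := by
  have hgb := norm_prod_mul_mean_le (x := fun _ => 1) hz (by simp)
  simp only [mul_one] at hgb
  rw [mul_sub, mul_one, mul_left_comm]
  refine (norm_sub_le _ _).trans ?_
  rw [norm_mul 2]
  have : ‖(2 : ℂ)‖ = 2 := by norm_num
  rw [this]
  linarith

variable {r : ℝ}

lemma singleBound_neg_one_le (hy : ∀ k, 0 < y k) (hr : ∀ k, |1 - y k| ≤ r * (1 + y k))
    (hr0 : 0 ≤ r) :
    singleBound y (-1) ≤ r ^ (Fintype.card ι - 1) * ∏ j, (1 + y j) := by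
  have hP : 0 ≤ r ^ (Fintype.card ι - 1) * ∏ j, (1 + y j) :=
    mul_nonneg (pow_nonneg hr0 _) (Finset.prod_nonneg fun j _ => by have := hy j; linarith)
  rw [singleBound]
  rcases Nat.eq_zero_or_pos (Fintype.card ι) with h0 | h0
  · rw [h0] at hP ⊢; simpa using hP
  rw [inv_mul_le_iff₀ (by exact_mod_cast h0), ← nsmul_eq_mul, ← Finset.card_univ]
  exact Finset.sum_le_card_nsmul _ _ _ fun k hk => norm_mul_norm_prod_erase_le hy hr _ hk

lemma pairBound_neg_one_le (hy : ∀ k, 0 < y k) (hr : ∀ k, |1 - y k| ≤ r * (1 + y k))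
    (hr0 : 0 ≤ r) :
    pairBound y (-1) ≤ r ^ (Fintype.card ι - 2) * ∏ j, (1 + y j) := by
  have hP : 0 ≤ r ^ (Fintype.card ι - 2) * ∏ j, (1 + y j) :=
    mul_nonneg (pow_nonneg hr0 _) (Finset.prod_nonneg fun j _ => by have := hy j; linarith)
  rw [pairBound]
  rcases Nat.eq_zero_or_pos (Fintype.card ι) with h0 | h0
  · rw [h0] at hP ⊢; simpa using hP
  rw [inv_mul_le_iff₀ (by exact_mod_cast h0), ← nsmul_eq_mul, ← Finset.card_univ]
  refine Finset.sum_le_card_nsmul _ _ _ fun k hk => ?_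
  rw [Finset.card_univ, inv_mul_le_iff₀ (by exact_mod_cast h0), ← nsmul_eq_mul]
  refine (Finset.sum_le_card_nsmul _ _ (r ^ (Fintype.card ι - 2) * ∏ j, (1 + y j))
    fun l hl => ?_).trans ?_
  · have h1 : ‖(-1 : ℂ) * y k‖ ≤ 1 + y k := by
      rw [neg_one_mul, norm_neg, Complex.norm_real, Real.norm_eq_abs, abs_of_pos (hy k)]; linarith
    have h2 := norm_mul_norm_prod_erase_le hy hr _ hl
    rw [Finset.card_erase_of_mem hk, Finset.card_univ, Nat.sub_sub] at h2
    rw [← Finset.mul_prod_erase _ _ hk, mul_left_comm, mul_assoc]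
    exact mul_le_mul h1 h2 (by positivity) (by have := hy k; linarith)
  · exact nsmul_le_nsmul_left hP (by rw [← Finset.card_univ]; exact Finset.card_le_univ _)

end ParityBound

/-! ### Riemann sums -/

/-- For `a` in the unit interval the sample point lies in its own cell of the uniform partition, so
uniform continuity bounds the error cell by cell. The shift `a` distinguishes the momenta of the two
sectors. -/
lemma tendsto_riemann_sum {f : ℝ → ℂ} (hf : Continuous f) {a : ℝ} (ha : a ∈ Set.Icc (0 : ℝ) 1) :
    Tendsto (fun n : ℕ => ((n + 1 : ℕ) : ℂ)⁻¹ * ∑ k ∈ Finset.range (n + 1),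
      f (-Real.pi + 2 * Real.pi * (k + a) / (n + 1 : ℕ))) atTop
      (𝓝 ((2 * Real.pi : ℂ)⁻¹ * ∫ p in (-Real.pi)..Real.pi, f p)) := by
  have hpi := Real.pi_pos
  rw [Metric.tendsto_atTop]
  intro ε hε
  obtain ⟨δ, hδ, hu⟩ := Metric.uniformContinuousOn_iff.1
    (isCompact_Icc.uniformContinuousOn_of_continuous
      (hf.continuousOn (s := Set.Icc (-Real.pi) Real.pi))) (ε / 2) (half_pos hε)
  obtain ⟨N, hN⟩ := exists_nat_gt (2 * Real.pi / δ)
  refine ⟨N, fun n hn => ?_⟩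
  set x : ℕ → ℝ := fun k => -Real.pi + 2 * Real.pi * k / (n + 1 : ℕ) with hx
  have hn0 : (0 : ℝ) < ((n + 1 : ℕ) : ℝ) := by positivity
  have hstep : ∀ k, x (k + 1) - x k = 2 * Real.pi / (n + 1 : ℕ) := fun k => by
    simp only [hx]; push_cast; ring
  have hsmall : 2 * Real.pi / (n + 1 : ℕ) < δ := by
    rw [div_lt_iff₀ hn0]
    rw [div_lt_iff₀ hδ] at hN
    have : (N : ℝ) ≤ (n + 1 : ℕ) := by exact_mod_cast hn.trans n.le_succ
    nlinarith
  have hpos : 0 < 2 * Real.pi / (n + 1 : ℕ) := by positivity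
  have hx0 : x 0 = -Real.pi := by simp [hx]
  have hxn : x (n + 1) = Real.pi := by simp only [hx]; field_simp; ring
  have hmono : Monotone x := monotone_nat_of_le_succ fun k => by linarith [hstep k]
  have hint : ∫ p in (-Real.pi)..Real.pi, f p =
      ∑ k ∈ Finset.range (n + 1), ∫ p in (x k)..(x (k + 1)), f p := by
    rw [intervalIntegral.sum_integral_adjacent_intervals
      fun k _ => hf.intervalIntegrable _ _, hx0, hxn]
  have hξ : ∀ k : ℕ, -Real.pi + 2 * Real.pi * (k + a) / (n + 1 : ℕ) =
      x k + a * (2 * Real.pi / (n + 1 : ℕ)) := fun k => by simp only [hx]; ring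
  have hsum : ((n + 1 : ℕ) : ℂ)⁻¹ * ∑ k ∈ Finset.range (n + 1),
      f (-Real.pi + 2 * Real.pi * (k + a) / (n + 1 : ℕ)) = (2 * Real.pi : ℂ)⁻¹ *
      ∑ k ∈ Finset.range (n + 1), ∫ _ in (x k)..(x (k + 1)),
        f (-Real.pi + 2 * Real.pi * (k + a) / (n + 1 : ℕ)) := by
    simp only [intervalIntegral.integral_const, hstep, ← Finset.smul_sum]
    rw [Complex.real_smul, ← mul_assoc]
    congr 1
    have : (Real.pi : ℂ) ≠ 0 := Complex.ofReal_ne_zero.2 hpi.ne'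
    push_cast
    field_simp
  rw [dist_eq_norm, hsum, hint, ← mul_sub, ← Finset.sum_sub_distrib, norm_mul]
  have hb : ∀ k ∈ Finset.range (n + 1),
      ‖(∫ _ in (x k)..(x (k + 1)), f (-Real.pi + 2 * Real.pi * (k + a) / (n + 1 : ℕ))) -
        ∫ p in (x k)..(x (k + 1)), f p‖ ≤ ε / 2 * (2 * Real.pi / (n + 1 : ℕ)) := by
    intro k hk
    have hk' := Finset.mem_range.1 hk
    rw [← intervalIntegral.integral_sub (by simp) (hf.intervalIntegrable _ _), ← hstep k]
    refine (intervalIntegral.norm_integral_le_of_norm_le_const (C := ε / 2) fun p hp => ?_).trans ?_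
    · rw [Set.uIoc_of_le (hmono k.le_succ)] at hp
      have h0 : -Real.pi ≤ x k := hx0 ▸ hmono k.zero_le
      have h1 : x (k + 1) ≤ Real.pi := hxn ▸ hmono hk'
      have hs := hstep k
      have ha0 := mul_nonneg ha.1 hpos.le
      have ha1 := mul_le_mul_of_nonneg_right ha.2 hpos.le
      rw [← dist_eq_norm, hξ]
      refine (hu _ ⟨by linarith, by linarith⟩ _ ⟨by linarith [hp.1], by linarith [hp.2]⟩ ?_).le
      rw [Real.dist_eq, abs_lt]
      constructor <;> linarith [hp.1, hp.2]
    · rw [abs_of_nonneg (by linarith [hstep k])]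
  have hnorm : ‖(2 * Real.pi : ℂ)⁻¹‖ = (2 * Real.pi)⁻¹ := by
    rw [norm_inv, norm_mul, Complex.norm_real, Real.norm_of_nonneg hpi.le]; norm_num
  rw [hnorm]
  have := (norm_sum_le _ _).trans (Finset.sum_le_sum hb)
  rw [Finset.sum_const, Finset.card_range, nsmul_eq_mul] at this
  calc _ ≤ (2 * Real.pi)⁻¹ * (((n + 1 : ℕ) : ℝ) * (ε / 2 * (2 * Real.pi / (n + 1 : ℕ)))) :=
        mul_le_mul_of_nonneg_left this (by positivity)
    _ = ε / 2 := by field_simp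
    _ < ε := half_lt_self hε

/-! ### Weighted averages -/

/-- A convex combination of two sequences with a common limit converges to it, however the weights
behave. -/
lemma tendsto_weighted_average {α γ : ℕ → ℝ} (hα : ∀ n, 0 < α n) (hγ : ∀ n, 0 < γ n)
    {f g : ℕ → ℂ} {l : ℂ} (hf : Tendsto f atTop (𝓝 l)) (hg : Tendsto g atTop (𝓝 l)) :
    Tendsto (fun n => (α n * f n + γ n * g n) / ((α n + γ n : ℝ) : ℂ)) atTop (𝓝 l) := by
  rw [tendsto_iff_norm_sub_tendsto_zero] at hf hg ⊢
  refine squeeze_zero (fun _ => norm_nonneg _) (fun n => ?_) (by simpa using hf.add hg)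
  have hs : 0 < α n + γ n := add_pos (hα n) (hγ n)
  have hs' : ((α n + γ n : ℝ) : ℂ) ≠ 0 := Complex.ofReal_ne_zero.2 hs.ne'
  have e : (α n * f n + γ n * g n) / ((α n + γ n : ℝ) : ℂ) - l =
      ((α n / (α n + γ n) : ℝ) : ℂ) * (f n - l) + ((γ n / (α n + γ n) : ℝ) : ℂ) * (g n - l) := by
    push_cast at hs' ⊢
    field_simp
    ring
  rw [e]
  refine (norm_add_le _ _).trans (add_le_add ?_ ?_)
  · rw [norm_mul, Complex.norm_real, Real.norm_of_nonneg (div_nonneg (hα n).le hs.le)]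
    exact mul_le_of_le_one_left (norm_nonneg _) ((div_le_one hs).2 (by linarith [hγ n]))
  · rw [norm_mul, Complex.norm_real, Real.norm_of_nonneg (div_nonneg (hγ n).le hs.le)]
    exact mul_le_of_le_one_left (norm_nonneg _) ((div_le_one hs).2 (by linarith [hα n]))

/-! ### The momenta of the two sectors -/

section Momenta

/-- The phase factor of a mode as a function of the momentum. -/
def bandFactor (p : ℝ) : ℂ := Complex.exp ((p + Real.pi : ℝ) * Complex.I)

/-- The shift of the momentum by `π` turns `4J cos` into `-4J cos`. Its price is the factor `(-1) ^
m` in `modePhase_bandFactor`. -/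
lemma modeEnergy_bandFactor (J h p : ℝ) : modeEnergy J h (bandFactor p) = (energy J h p : ℂ) := by
  have h1 : bandFactor p + (bandFactor p)⁻¹ = -(2 * Complex.cos p) := by
    rw [bandFactor, ← Complex.exp_neg, ← neg_mul, ← Complex.two_cos, Complex.ofReal_add,
      Complex.cos_add_pi]
    ring
  rw [modeEnergy, h1, energy]
  push_cast
  ring

lemma boltzmann_bandFactor (J h β p : ℝ) :
    boltzmann J h β (bandFactor p) = (Real.exp (-β * energy J h p) : ℂ) := by
  rw [boltzmann, modeEnergy_bandFactor]; push_cast; rfl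

lemma modePhase_bandFactor (J h t : ℝ) (m : ℕ) (p : ℝ) :
    modePhase J h t m (bandFactor p) =
      (-1) ^ m * Complex.exp (Complex.I * (m * p - t * energy J h p : ℝ)) := by
  have h1 : bandFactor p = -Complex.exp (Complex.I * p) := by
    rw [bandFactor, Complex.ofReal_add, add_mul, Complex.exp_add, Complex.exp_pi_mul_I, mul_neg_one,
      mul_comm]
  rw [modePhase, modeEnergy_bandFactor, h1, neg_pow, ← Complex.exp_nat_mul, mul_assoc,
    ← Complex.exp_add]
  congr 2
  push_cast
  ring

lemma norm_modePhase_bandFactor (J h t : ℝ) (m : ℕ) (p : ℝ) :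
    ‖modePhase J h t m (bandFactor p)‖ = 1 := by
  rw [modePhase_bandFactor, norm_mul, norm_pow, norm_neg, norm_one, one_pow, one_mul, mul_comm,
    Complex.norm_exp_ofReal_mul_I]

/-- The `k`-th momentum of the sector with phase shift `a`. -/
def sectorMomentum (a : ℝ) (L k : ℕ) : ℝ := -Real.pi + 2 * Real.pi * (k + a) / L

/-- The phase factors of the modes of the sector with phase shift `a`. -/
def sectorMode (a : ℝ) (L : ℕ) (k : ZMod L) : ℂ := bandFactor (sectorMomentum a L k.val)

lemma isModeSystem_sectorMode {L : ℕ} [NeZero L] {a : ℝ} {κ : ℂ}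
    (hκ : κ = Complex.exp (2 * Real.pi * a * Complex.I)) (hsq : κ * κ = 1) :
    IsModeSystem κ (sectorMode a L) where
  sq := hsq
  pow k := by
    have hL : (L : ℂ) ≠ 0 := Nat.cast_ne_zero.2 (NeZero.ne L)
    rw [sectorMode, bandFactor, ← Complex.exp_nat_mul, hκ, Complex.exp_eq_exp_iff_exists_int]
    -- The offset `-π` of the momentum cancels the shift in `bandFactor`, so the total phase is `2π
    -- (k + a)`.
    refine ⟨k.val, ?_⟩
    rw [sectorMomentum]
    push_cast
    field_simp
    ring
  inj k l hkl := by
    have hL : (L : ℂ) ≠ 0 := Nat.cast_ne_zero.2 (NeZero.ne L)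
    have hπ : (Real.pi : ℂ) ≠ 0 := Complex.ofReal_ne_zero.2 Real.pi_ne_zero
    obtain ⟨n, hn⟩ := Complex.exp_eq_exp_iff_exists_int.1 hkl
    simp only [sectorMomentum] at hn
    push_cast at hn
    have h1 : (k.val : ℂ) = l.val + n * L := by
      field_simp at hn
      linear_combination hn / 2
    have h3 : (k.val : ℤ) = l.val + n * L := by exact_mod_cast h1
    have h4 : (k.val : ℤ) % L = (l.val : ℤ) % L := by rw [h3, Int.add_mul_emod_self_right]
    rw [Int.emod_eq_of_lt (by positivity) (by exact_mod_cast ZMod.val_lt k),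
      Int.emod_eq_of_lt (by positivity) (by exact_mod_cast ZMod.val_lt l)] at h4
    exact ZMod.val_injective L (by exact_mod_cast h4)
  norm k := by rw [sectorMode, bandFactor, Complex.norm_exp_ofReal_mul_I]

lemma isModeSystem_periodic (L : ℕ) [NeZero L] : IsModeSystem 1 (sectorMode 0 L) :=
  isModeSystem_sectorMode (by simp) (by ring)

lemma isModeSystem_antiperiodic (L : ℕ) [NeZero L] : IsModeSystem (-1) (sectorMode (1 / 2) L) := by
  refine isModeSystem_sectorMode ?_ (by ring)
  rw [← Complex.exp_pi_mul_I]
  congr 1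
  push_cast
  ring

end Momenta

/-! ### Contributions of a sector -/

section Sector

/-- The mean occupation number of momentum `p`. -/
def fermi (J h β p : ℝ) : ℝ := Real.exp (-β * energy J h p) / (1 + Real.exp (-β * energy J h p))

lemma occupation_bandFactor (J h β : ℝ) (z : ℂ) (p : ℝ) :
    occupation J h β z (bandFactor p) = z * (Real.exp (-β * energy J h p) : ℂ) /
      (1 + z * (Real.exp (-β * energy J h p) : ℂ)) := by
  rw [← boltzmann_bandFactor]; rfl

lemma occupation_one_bandFactor (J h β p : ℝ) :
    occupation J h β 1 (bandFactor p) = (fermi J h β p : ℂ) := by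
  rw [occupation_bandFactor, fermi, one_mul]; push_cast; rfl

lemma continuous_energy (J h : ℝ) : Continuous (energy J h) := by unfold energy; fun_prop

lemma continuous_fermi (J h β : ℝ) : Continuous (fermi J h β) := by
  have := continuous_energy J h
  unfold fermi
  exact (by fun_prop : Continuous fun p => Real.exp (-β * energy J h p)).div (by fun_prop)
    fun p => by positivity

lemma continuous_modePhase_bandFactor (J h t : ℝ) (m : ℕ) :
    Continuous fun p => modePhase J h t m (bandFactor p) := by
  have := continuous_energy J h
  simp only [modePhase_bandFactor]
  fun_prop

/-- The real partition function of a sector. -/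
def sectorPartition (J h β a : ℝ) (L : ℕ) [NeZero L] : ℝ :=
  Real.exp (β * h * L / 2) *
    ∏ k : ZMod L, (1 + Real.exp (-β * energy J h (sectorMomentum a L k.val)))

lemma sectorPartition_pos (J h β a : ℝ) (L : ℕ) [NeZero L] : 0 < sectorPartition J h β a L :=
  mul_pos (Real.exp_pos _) (Finset.prod_pos fun k _ => by positivity)

/-- The rate at which the parity contributions decay with the length of the chain. -/
def parityRate (J h β : ℝ) : ℝ :=
  (1 - Real.exp (-(|β| * (|h| + 4 * |J|)))) / (1 + Real.exp (-(|β| * (|h| + 4 * |J|))))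

lemma parityRate_nonneg (J h β : ℝ) : 0 ≤ parityRate J h β :=
  div_nonneg (sub_nonneg.2 (Real.exp_le_one_iff.2 (neg_nonpos.2 (by positivity)))) (by positivity)

lemma parityRate_lt_one (J h β : ℝ) : parityRate J h β < 1 := by
  have := Real.exp_pos (-(|β| * (|h| + 4 * |J|)))
  rw [parityRate, div_lt_one (by linarith)]
  linarith

lemma abs_energy_le (J h p : ℝ) : |energy J h p| ≤ |h| + 4 * |J| := by
  rw [energy]
  refine (abs_sub _ _).trans ?_
  rw [abs_mul, abs_mul]
  have h1 := Real.abs_cos_le_one p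
  have h2 : |(4 : ℝ)| = 4 := by norm_num
  rw [h2]
  nlinarith [abs_nonneg J]

/-- The quotient `|1 - y| / (1 + y)` is `|tanh (β ε / 2)|`, and the rate is `tanh (M / 2)` for a
bound `M` on `|β ε|`. -/
lemma abs_one_sub_boltzmann_le (J h β p : ℝ) :
    |1 - Real.exp (-β * energy J h p)| ≤
      parityRate J h β * (1 + Real.exp (-β * energy J h p)) := by
  have hM : |β * energy J h p| ≤ |β| * (|h| + 4 * |J|) := by
    rw [abs_mul]; exact mul_le_mul_of_nonneg_left (abs_energy_le J h p) (abs_nonneg β)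
  obtain ⟨hM1, hM2⟩ := abs_le.1 hM
  set M := |β| * (|h| + 4 * |J|)
  have hδ := Real.exp_pos (-M)
  have hy := Real.exp_pos (-β * energy J h p)
  have h1 : Real.exp (-M) ≤ Real.exp (-β * energy J h p) := Real.exp_le_exp.2 (by linarith)
  have h2 : Real.exp (-M) * Real.exp (-β * energy J h p) ≤ 1 := by
    rw [← Real.exp_add, Real.exp_le_one_iff]; linarith
  rw [parityRate, div_mul_eq_mul_div, le_div_iff₀ (by linarith)]
  rcases abs_cases (1 - Real.exp (-β * energy J h p)) with ⟨e, _⟩ | ⟨e, _⟩ <;> rw [e] <;> nlinarith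

lemma one_add_boltzmann_ne_zero {L : ℕ} (J h β a : ℝ) (k : ZMod L) :
    1 + 1 * boltzmann J h β (sectorMode a L k) ≠ 0 := by
  rw [one_mul, sectorMode, boltzmann_bandFactor]
  exact_mod_cast (by positivity : (0 : ℝ) <
    1 + Real.exp (-β * energy J h (sectorMomentum a L k.val))).ne'

variable {L : ℕ} [NeZero L] {κ : ℂ} {a : ℝ}

lemma twistedTrace_sector_one (hw : IsModeSystem κ (sectorMode a L)) (J h β : ℝ) (z : ℂ) :
    twistedTrace L J h β κ z 1 = Real.exp (β * h * L / 2) *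
      ∏ k : ZMod L, (1 + z * (Real.exp (-β * energy J h (sectorMomentum a L k.val)) : ℂ)) := by
  simp only [twistedTrace_one hw, sectorMode, boltzmann_bandFactor]

lemma twistedTrace_one_one (hw : IsModeSystem κ (sectorMode a L)) (J h β : ℝ) :
    twistedTrace L J h β κ 1 1 = sectorPartition J h β a L := by
  rw [twistedTrace_sector_one hw, sectorPartition]
  push_cast
  simp only [one_mul]

lemma norm_twistedTrace_neg_one_one_le (hw : IsModeSystem κ (sectorMode a L)) (J h β : ℝ) :
    ‖twistedTrace L J h β κ (-1) 1‖ ≤ sectorPartition J h β a L * parityRate J h β ^ L := by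
  rw [twistedTrace_sector_one hw, norm_mul, Complex.norm_real,
    Real.norm_of_nonneg (Real.exp_pos _).le, sectorPartition, mul_assoc (Real.exp _)]
  refine mul_le_mul_of_nonneg_left ?_ (Real.exp_pos _).le
  have := norm_prod_one_sub_le
    (fun k : ZMod L => abs_one_sub_boltzmann_le J h β (sectorMomentum a L k.val)) Finset.univ
  rwa [Finset.card_univ, ZMod.card, mul_comm] at this

/-- The total spin `∑ⱼ σⱼᶻ / 2`. -/
def totalSpin (L : ℕ) [NeZero L] : Op L := (1 / 2 : ℂ) • ∑ j : ZMod L, site L j pauliZ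

lemma twistedTrace_totalSpin {w : ZMod L → ℂ} (hw : IsModeSystem κ w) (J h β : ℝ) {z : ℂ}
    (hz : ∀ k, 1 + z * boltzmann J h β (w k) ≠ 0) :
    twistedTrace L J h β κ z (totalSpin L) =
      L / 2 * (1 - 2 * meanOccupation J h β z w) * twistedTrace L J h β κ z 1 := by
  have h1 : twistedTrace L J h β κ z (totalSpin L) =
      1 / 2 * ∑ j : ZMod L, twistedTrace L J h β κ z (site L j pauliZ) := by
    simp only [twistedTrace, totalSpin, mul_smul_comm, Matrix.trace_smul, smul_eq_mul,
      Finset.mul_sum, Matrix.trace_sum]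
  rw [h1, Finset.sum_congr rfl fun j _ => twistedTrace_pauliZ hw J h β hz j, Finset.sum_const,
    Finset.card_univ, ZMod.card, nsmul_eq_mul]
  ring

lemma norm_twistedTrace_neg_one_totalSpin_le (hw : IsModeSystem κ (sectorMode a L)) (J h β : ℝ) :
    ‖twistedTrace L J h β κ (-1) (totalSpin L)‖ ≤
      L / 2 * (sectorPartition J h β a L * (3 * parityRate J h β ^ (L - 1))) := by
  set y : ZMod L → ℝ := fun k => Real.exp (-β * energy J h (sectorMomentum a L k.val)) with hy
  have hypos : ∀ k, 0 < y k := fun k => Real.exp_pos _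
  have hb : ∀ k, boltzmann J h β (sectorMode a L k) = (y k : ℂ) := fun k => by
    rw [sectorMode, boltzmann_bandFactor]
  have hr : ∀ k, |1 - y k| ≤ parityRate J h β * (1 + y k) := fun k =>
    abs_one_sub_boltzmann_le J h β _
  have hr0 := parityRate_nonneg J h β
  have hr1 := (parityRate_lt_one J h β).le
  have key := norm_neg_one_le_of_generic
    (F := fun z => ‖twistedTrace L J h β κ z (totalSpin L)‖)
    (B := fun z => L / 2 * (Real.exp (β * h * L / 2) *
      (‖∏ j, (1 + z * (y j : ℂ))‖ + 2 * singleBound y z)))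
    (continuous_twistedTrace J h β κ _).norm
    (by have := continuous_singleBound y; fun_prop)
    (fun z hz => by
      have hz' : ∀ k, 1 + z * boltzmann J h β (sectorMode a L k) ≠ 0 := fun k => by
        rw [hb]; exact hz k
      have h1 := norm_prod_mul_magnetization_le hz
      rw [ZMod.card] at h1
      have hocc : ∀ k, occupation J h β z (sectorMode a L k) = z * y k / (1 + z * y k) := fun k => by
        rw [sectorMode, occupation_bandFactor]
      have hm : meanOccupation J h β z (sectorMode a L) =
          (L : ℂ)⁻¹ * ∑ k, z * y k / (1 + z * y k) := by
        simp only [meanOccupation, hocc]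
      rw [← hm] at h1
      rw [twistedTrace_totalSpin hw J h β hz', twistedTrace_sector_one hw, mul_assoc, norm_mul,
        mul_left_comm, norm_mul _ (_ * _), Complex.norm_real,
        Real.norm_of_nonneg (Real.exp_pos _).le, mul_comm (1 - _)]
      have hL2 : ‖(L / 2 : ℂ)‖ = L / 2 := by simp
      rw [hL2]
      gcongr) hypos
  refine key.trans ?_
  rw [sectorPartition, mul_assoc (Real.exp _)]
  refine mul_le_mul_of_nonneg_left (mul_le_mul_of_nonneg_left ?_ (Real.exp_pos _).le) (by positivity)
  have h1 := norm_prod_one_sub_le hr Finset.univ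
  have h2 := singleBound_neg_one_le hypos hr hr0
  rw [Finset.card_univ, ZMod.card] at h1
  rw [ZMod.card] at h2
  have hP : 0 ≤ ∏ j, (1 + y j) := Finset.prod_nonneg fun j _ => by have := hypos j; linarith
  -- The constant `3` is `1 + 2`, once all powers of the rate are weakened to `L - 1`.
  have h3 := mul_le_mul_of_nonneg_right (pow_le_pow_of_le_one hr0 hr1 (Nat.sub_le L 1)) hP
  linarith

/-- The longitudinal two-point function in a sector without the parity contribution. -/
def sectorCorrelation {L : ℕ} [NeZero L] (J h β t : ℝ) (m : ℕ) (z : ℂ) (w : ZMod L → ℂ) : ℂ :=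
  (1 - 2 * meanOccupation J h β z w) ^ 2 +
    4 * (particlePropagator J h β t m z w * holePropagator J h β t m z w)

lemma norm_twistedTrace_neg_one_pauliZ_pauliZ_le (hw : IsModeSystem κ (sectorMode a L))
    (J h β t : ℝ) (m : ZMod L) :
    ‖twistedTrace L J h β κ (-1)
        (site L 0 pauliZ * twistedHeisenberg L J h κ t (site L m pauliZ))‖ ≤
      sectorPartition J h β a L * (17 * parityRate J h β ^ (L - 2)) := by
  set y : ZMod L → ℝ := fun k => Real.exp (-β * energy J h (sectorMomentum a L k.val)) with hy
  have hypos : ∀ k, 0 < y k := fun k => Real.exp_pos _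
  have hb : ∀ k, boltzmann J h β (sectorMode a L k) = (y k : ℂ) := fun k => by
    rw [sectorMode, boltzmann_bandFactor]
  have hr : ∀ k, |1 - y k| ≤ parityRate J h β * (1 + y k) := fun k =>
    abs_one_sub_boltzmann_le J h β _
  have hr0 := parityRate_nonneg J h β
  have hr1 := (parityRate_lt_one J h β).le
  have key := norm_neg_one_le_of_generic
    (F := fun z => ‖twistedTrace L J h β κ z
      (site L 0 pauliZ * twistedHeisenberg L J h κ t (site L m pauliZ))‖)
    (B := fun z => Real.exp (β * h * L / 2) *
      (‖∏ j, (1 + z * (y j : ℂ))‖ + 8 * singleBound y z + 8 * pairBound y z))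
    (continuous_twistedTrace J h β κ _).norm
    (by
      have := continuous_singleBound y
      have := continuous_pairBound y
      fun_prop)
    (fun z hz => by
      have hz' : ∀ k, 1 + z * boltzmann J h β (sectorMode a L k) ≠ 0 := fun k => by
        rw [hb]; exact hz k
      have h1 := norm_prod_mul_correlation_le hz (x := fun k => modePhase J h t m.val
        (sectorMode a L k)) fun k => norm_modePhase_bandFactor J h t m.val _
      rw [ZMod.card] at h1
      have hocc : ∀ k, occupation J h β z (sectorMode a L k) = z * y k / (1 + z * y k) := fun k => by
        rw [sectorMode, occupation_bandFactor]
      simp only [← hocc] at h1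
      rw [twistedTrace_pauliZ_pauliZ hw J h β t hz', twistedTrace_sector_one hw,
        mul_left_comm, norm_mul, Complex.norm_real,
        Real.norm_of_nonneg (Real.exp_pos _).le, mul_comm (_ + _)]
      exact mul_le_mul_of_nonneg_left h1 (Real.exp_pos _).le) hypos
  refine key.trans ?_
  rw [sectorPartition, mul_assoc (Real.exp _)]
  refine mul_le_mul_of_nonneg_left ?_ (Real.exp_pos _).le
  have h1 := norm_prod_one_sub_le hr Finset.univ
  have h2 := singleBound_neg_one_le hypos hr hr0
  have h4 := pairBound_neg_one_le hypos hr hr0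
  rw [Finset.card_univ, ZMod.card] at h1
  rw [ZMod.card] at h2 h4
  have hP : 0 ≤ ∏ j, (1 + y j) := Finset.prod_nonneg fun j _ => by have := hypos j; linarith
  -- The constant `17` is `1 + 8 + 8`; a pair term lacks two factors of the product, hence the
  -- common power `L - 2`.
  have h3 := mul_le_mul_of_nonneg_right (pow_le_pow_of_le_one hr0 hr1 (Nat.sub_le L 2)) hP
  have h5 := mul_le_mul_of_nonneg_right
    (pow_le_pow_of_le_one hr0 hr1 (Nat.sub_le_sub_left one_le_two L)) hP
  linarith

end Sector

/-! ### The thermodynamic limit -/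

section Thermodynamic

lemma tendsto_sectorMode_average {f : ℂ → ℂ} (hf : Continuous fun p => f (bandFactor p)) {a : ℝ}
    (ha : a ∈ Set.Icc (0 : ℝ) 1) :
    Tendsto (fun n : ℕ => ((n + 1 : ℕ) : ℂ)⁻¹ * ∑ k : ZMod (n + 1), f (sectorMode a (n + 1) k)) atTop
      (𝓝 ((2 * Real.pi : ℂ)⁻¹ * ∫ p in (-Real.pi)..Real.pi, f (bandFactor p))) := by
  refine (tendsto_riemann_sum hf ha).congr fun n => ?_
  rw [← sum_zmod_val fun k => f (bandFactor (-Real.pi + 2 * Real.pi * (k + a) / (n + 1 : ℕ)))]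
  rfl

/-- The particle density in the thermodynamic limit. -/
def density (J h β : ℝ) : ℂ :=
  (2 * Real.pi : ℂ)⁻¹ * ∫ p in (-Real.pi)..Real.pi, (fermi J h β p : ℂ)

/-- The particle propagator in the thermodynamic limit. -/
def particleLimit (J h β t : ℝ) (m : ℕ) : ℂ :=
  (2 * Real.pi : ℂ)⁻¹ *
    ∫ p in (-Real.pi)..Real.pi, (fermi J h β p : ℂ) * modePhase J h t m (bandFactor p)

/-- The hole propagator in the thermodynamic limit. -/
def holeLimit (J h β t : ℝ) (m : ℕ) : ℂ :=
  (2 * Real.pi : ℂ)⁻¹ *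
    ∫ p in (-Real.pi)..Real.pi, (1 - fermi J h β p : ℂ) * (modePhase J h t m (bandFactor p))⁻¹

lemma tendsto_meanOccupation (J h β : ℝ) {a : ℝ} (ha : a ∈ Set.Icc (0 : ℝ) 1) :
    Tendsto (fun n : ℕ => meanOccupation J h β 1 (sectorMode a (n + 1))) atTop
      (𝓝 (density J h β)) := by
  have h1 := tendsto_sectorMode_average (f := occupation J h β 1) (a := a) (by
    simp only [occupation_one_bandFactor]
    exact Complex.continuous_ofReal.comp (continuous_fermi J h β)) ha
  simp only [occupation_one_bandFactor] at h1
  exact h1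

lemma tendsto_particlePropagator (J h β t : ℝ) (m : ℕ) {a : ℝ} (ha : a ∈ Set.Icc (0 : ℝ) 1) :
    Tendsto (fun n : ℕ => particlePropagator J h β t m 1 (sectorMode a (n + 1))) atTop
      (𝓝 (particleLimit J h β t m)) := by
  have h1 := tendsto_sectorMode_average
    (f := fun w => occupation J h β 1 w * modePhase J h t m w) (a := a) (by
    simp only [occupation_one_bandFactor]
    exact (Complex.continuous_ofReal.comp (continuous_fermi J h β)).mul
      (continuous_modePhase_bandFactor J h t m)) ha
  simp only [occupation_one_bandFactor] at h1
  exact h1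

lemma modePhase_bandFactor_ne_zero (J h t : ℝ) (m : ℕ) (p : ℝ) :
    modePhase J h t m (bandFactor p) ≠ 0 := by
  rw [← norm_ne_zero_iff, norm_modePhase_bandFactor]; exact one_ne_zero

lemma tendsto_holePropagator (J h β t : ℝ) (m : ℕ) {a : ℝ} (ha : a ∈ Set.Icc (0 : ℝ) 1) :
    Tendsto (fun n : ℕ => holePropagator J h β t m 1 (sectorMode a (n + 1))) atTop
      (𝓝 (holeLimit J h β t m)) := by
  have h1 := tendsto_sectorMode_average
    (f := fun w => (1 - occupation J h β 1 w) * (modePhase J h t m w)⁻¹) (a := a) (by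
    simp only [occupation_one_bandFactor]
    exact (continuous_const.sub (Complex.continuous_ofReal.comp (continuous_fermi J h β))).mul
      ((continuous_modePhase_bandFactor J h t m).inv₀ (modePhase_bandFactor_ne_zero J h t m))) ha
  simp only [occupation_one_bandFactor] at h1
  exact h1

/-- The two-point function of `σᶻ` in the thermodynamic limit. -/
def correlationLimit (J h β t : ℝ) (m : ℕ) : ℂ :=
  (1 - 2 * density J h β) ^ 2 + 4 * (particleLimit J h β t m * holeLimit J h β t m)

lemma tendsto_sectorCorrelation (J h β t : ℝ) (m : ℕ) {a : ℝ} (ha : a ∈ Set.Icc (0 : ℝ) 1) :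
    Tendsto (fun n : ℕ => sectorCorrelation J h β t m 1 (sectorMode a (n + 1))) atTop
      (𝓝 (correlationLimit J h β t m)) :=
  (((tendsto_meanOccupation J h β ha).const_mul 2).const_sub 1).pow 2 |>.add
    (((tendsto_particlePropagator J h β t m ha).mul
      (tendsto_holePropagator J h β t m ha)).const_mul 4)

/-- Divided by `α + γ`, numerator and denominator become weighted averages over the sectors, tending
to `W` and `1`; each parity term is small relative to the weight of its own sector. -/
lemma tendsto_sector_ratio {α γ : ℕ → ℝ} (hα : ∀ n, 0 < α n) (hγ : ∀ n, 0 < γ n)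
    {num den f f' g g' d d' : ℕ → ℂ} {W : ℂ} {r : ℕ → ℝ}
    (hr : Tendsto r atTop (𝓝 0))
    (hnum : ∀ᶠ n in atTop, 2 * num n = (α n * f n + f' n) + (γ n * g n - g' n))
    (hden : ∀ᶠ n in atTop, 2 * den n = (α n + d n) + (γ n - d' n))
    (hf : Tendsto f atTop (𝓝 W)) (hg : Tendsto g atTop (𝓝 W))
    (hf' : ∀ n, ‖f' n‖ ≤ α n * r n) (hg' : ∀ n, ‖g' n‖ ≤ γ n * r n)
    (hd : ∀ n, ‖d n‖ ≤ α n * r n) (hd' : ∀ n, ‖d' n‖ ≤ γ n * r n) :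
    Tendsto (fun n => num n / den n) atTop (𝓝 W) := by
  have small : ∀ {δ : ℕ → ℝ} {e : ℕ → ℂ}, (∀ n, 0 < δ n) → (∀ n, ‖e n‖ ≤ δ n * r n) →
      Tendsto (fun n => e n / δ n) atTop (𝓝 0) := fun {δ e} hδ he =>
    squeeze_zero_norm (fun n => by
      rw [norm_div, Complex.norm_real, Real.norm_of_nonneg (hδ n).le, div_le_iff₀ (hδ n), mul_comm]
      exact he n) hr
  have h1 := tendsto_weighted_average hα hγ (by simpa using hf.add (small hα hf'))
    (by simpa using hg.sub (small hγ hg'))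
  have h2 := tendsto_weighted_average hα hγ (l := 1)
    (by simpa using (small hα hd).const_add 1) (by simpa using (small hγ hd').const_sub 1)
  have h3 := h1.div h2 one_ne_zero
  rw [div_one] at h3
  refine h3.congr' ?_
  filter_upwards [hnum, hden] with n hn hd
  have hα' : (α n : ℂ) ≠ 0 := Complex.ofReal_ne_zero.2 (hα n).ne'
  have hγ' : (γ n : ℂ) ≠ 0 := Complex.ofReal_ne_zero.2 (hγ n).ne'
  have hs : ((α n + γ n : ℝ) : ℂ) ≠ 0 := Complex.ofReal_ne_zero.2 (add_pos (hα n) (hγ n)).ne'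
  rw [Pi.div_apply, div_div_div_cancel_right₀ hs, ← mul_div_mul_left (num n) (den n) (two_ne_zero' ℂ), hn, hd]
  congr 1
  · field_simp
  · field_simp

lemma two_mul_trace_exp_hamiltonian {L : ℕ} [NeZero L] (hL : 2 ≤ L) (J h β : ℝ) :
    2 * (NormedSpace.exp (-(β : ℂ) • hamiltonian L J h)).trace =
      (sectorPartition J h β (1 / 2) L + twistedTrace L J h β (-1) (-1) 1) +
      (sectorPartition J h β 0 L - twistedTrace L J h β 1 (-1) 1) := by
  have h1 : ∀ κ : ℂ, (1 : Op L) * twistedHeisenberg L J h κ 0 1 = 1 := fun κ => by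
    rw [twistedHeisenberg, mul_one, one_mul, exp_smul_mul_exp_neg_smul]
  have h2 : (1 : Op L) * heisenberg L J h 0 1 = 1 := by
    rw [heisenberg, mul_one, one_mul, exp_smul_mul_exp_neg_smul]
  have h3 := trace_exp_hamiltonian_mul (L := L) hL J h β 0 (Commute.one_left _) (Commute.one_left _)
  rw [h1, h1, h2, mul_one, twistedTrace_one_one (isModeSystem_antiperiodic L),
    twistedTrace_one_one (isModeSystem_periodic L)] at h3
  exact h3

lemma heisenberg_zero {L : ℕ} [NeZero L] (J h : ℝ) (A : Op L) : heisenberg L J h 0 A = A := by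
  simp [heisenberg]

lemma twistedHeisenberg_zero {L : ℕ} [NeZero L] (J h : ℝ) (κ : ℂ) (A : Op L) :
    twistedHeisenberg L J h κ 0 A = A := by
  simp [twistedHeisenberg]

lemma commute_site_pauliZ_parity {L : ℕ} [NeZero L] (j : ZMod L) :
    Commute (site L j pauliZ) (fugacity (-1)) := (fugacity_comm_site_pauliZ (-1) j).symm

lemma tendsto_mul_parityRate_pow (J h β c : ℝ) (i : ℕ) :
    Tendsto (fun n : ℕ => c * parityRate J h β ^ (n + 1 - i)) atTop (𝓝 0) := by
  have h1 := (tendsto_pow_atTop_nhds_zero_of_lt_one (parityRate_nonneg J h β)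
    (parityRate_lt_one J h β)).comp (tendsto_sub_atTop_nat i |>.comp (tendsto_add_atTop_nat 1))
  simpa using h1.const_mul c

lemma half_mem_Icc : (1 / 2 : ℝ) ∈ Set.Icc (0 : ℝ) 1 := by constructor <;> norm_num

lemma zero_mem_Icc : (0 : ℝ) ∈ Set.Icc (0 : ℝ) 1 := by constructor <;> norm_num

lemma norm_twistedTrace_neg_one_one_le_mul {κ : ℂ} {a : ℝ} {n : ℕ}
    (hw : IsModeSystem κ (sectorMode a (n + 1))) (J h β : ℝ) {c : ℝ} (hc : 1 ≤ c) (i : ℕ) :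
    ‖twistedTrace (n + 1) J h β κ (-1) 1‖ ≤
      sectorPartition J h β a (n + 1) * (c * parityRate J h β ^ (n + 1 - i)) := by
  refine (norm_twistedTrace_neg_one_one_le hw J h β).trans
    (mul_le_mul_of_nonneg_left ?_ (sectorPartition_pos J h β a (n + 1)).le)
  have hr0 := parityRate_nonneg J h β
  exact (pow_le_pow_of_le_one hr0 (parityRate_lt_one J h β).le (Nat.sub_le (n + 1) i)).trans
    (le_mul_of_one_le_left (pow_nonneg hr0 _) hc)

theorem tendsto_finiteDynCorr (J h β t : ℝ) (m : ℕ) :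
    Tendsto (fun n : ℕ => finiteDynCorr (n + 1) J h β t m) atTop
      (𝓝 (correlationLimit J h β t m)) := by
  -- The residue of `m` represents the distance `m` only once the chain is longer than `m`.
  have hval : ∀ᶠ n : ℕ in atTop, ((m : ZMod (n + 1)).val = m) := by
    filter_upwards [eventually_ge_atTop m] with n hn
    exact ZMod.val_cast_of_lt (Nat.lt_succ_of_le hn)
  have hcorr : ∀ {a : ℝ}, a ∈ Set.Icc (0 : ℝ) 1 → Tendsto (fun n : ℕ =>
      sectorCorrelation J h β t (m : ZMod (n + 1)).val 1 (sectorMode a (n + 1))) atTop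
      (𝓝 (correlationLimit J h β t m)) := fun ha =>
    (tendsto_sectorCorrelation J h β t m ha).congr' (by
      filter_upwards [hval] with n hn
      rw [hn])
  refine tendsto_sector_ratio (fun n => sectorPartition_pos J h β (1 / 2) (n + 1))
    (fun n => sectorPartition_pos J h β 0 (n + 1))
    (tendsto_mul_parityRate_pow J h β 17 2) ?_ ?_ (hcorr half_mem_Icc) (hcorr zero_mem_Icc)
    (fun n => norm_twistedTrace_neg_one_pauliZ_pauliZ_le (isModeSystem_antiperiodic (n + 1))
      J h β t m)
    (fun n => norm_twistedTrace_neg_one_pauliZ_pauliZ_le (isModeSystem_periodic (n + 1)) J h β t m)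
    (fun n => norm_twistedTrace_neg_one_one_le_mul (isModeSystem_antiperiodic (n + 1)) J h β
      (by norm_num) 2)
    (fun n => norm_twistedTrace_neg_one_one_le_mul (isModeSystem_periodic (n + 1)) J h β
      (by norm_num) 2)
  · filter_upwards [eventually_ge_atTop 1] with n hn
    rw [trace_exp_hamiltonian_mul (Nat.succ_le_succ hn) J h β t (commute_site_pauliZ_parity _)
      (commute_site_pauliZ_parity _),
      twistedTrace_pauliZ_pauliZ (isModeSystem_antiperiodic (n + 1)) J h β t
        (one_add_boltzmann_ne_zero J h β _),
      twistedTrace_pauliZ_pauliZ (isModeSystem_periodic (n + 1)) J h β t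
        (one_add_boltzmann_ne_zero J h β _),
      twistedTrace_one_one (isModeSystem_antiperiodic _),
      twistedTrace_one_one (isModeSystem_periodic _), sectorCorrelation, sectorCorrelation]
    ring
  · filter_upwards [eventually_ge_atTop 1] with n hn
    exact two_mul_trace_exp_hamiltonian (Nat.succ_le_succ hn) J h β

theorem tendsto_finiteStaticCorr (J h β : ℝ) (m : ℕ) :
    Tendsto (fun n : ℕ => finiteStaticCorr (n + 1) J h β m) atTop
      (𝓝 (correlationLimit J h β 0 m)) := by
  refine (tendsto_finiteDynCorr J h β 0 m).congr fun n => ?_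
  rw [finiteDynCorr, heisenberg_zero, finiteStaticCorr]

theorem tendsto_finiteMagnetization (J h β : ℝ) :
    Tendsto (fun n : ℕ => finiteMagnetization (n + 1) J h β) atTop
      (𝓝 (1 / 2 * (1 - 2 * density J h β))) := by
  have hmag : ∀ {a : ℝ}, a ∈ Set.Icc (0 : ℝ) 1 → Tendsto (fun n : ℕ =>
      1 / 2 * (1 - 2 * meanOccupation J h β 1 (sectorMode a (n + 1)))) atTop
      (𝓝 (1 / 2 * (1 - 2 * density J h β))) := fun ha =>
    (((tendsto_meanOccupation J h β ha).const_mul 2).const_sub 1).const_mul (1 / 2)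
  have hparity : ∀ {κ : ℂ} {a : ℝ} (n : ℕ), IsModeSystem κ (sectorMode a (n + 1)) →
      ‖twistedTrace (n + 1) J h β κ (-1) (totalSpin (n + 1)) / (n + 1 : ℕ)‖ ≤
        sectorPartition J h β a (n + 1) * (3 * parityRate J h β ^ (n + 1 - 1)) := by
    intro κ a n hw
    have hn : (0 : ℝ) < (n + 1 : ℕ) := by positivity
    rw [norm_div, Complex.norm_natCast, div_le_iff₀ hn]
    refine (norm_twistedTrace_neg_one_totalSpin_le hw J h β).trans ?_
    have := mul_nonneg (sectorPartition_pos J h β a (n + 1)).le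
      (mul_nonneg (by norm_num : (0 : ℝ) ≤ 3) (pow_nonneg (parityRate_nonneg J h β) (n + 1 - 1)))
    -- Only half of the available bound is used: the division by `L` leaves a factor `1 / 2`.
    nlinarith
  have hcomm : ∀ n : ℕ, Commute (totalSpin (n + 1)) (fugacity (-1)) := fun n =>
    (Commute.sum_left _ _ _ fun j _ => commute_site_pauliZ_parity j).smul_left _
  have key := tendsto_sector_ratio (fun n => sectorPartition_pos J h β (1 / 2) (n + 1))
    (fun n => sectorPartition_pos J h β 0 (n + 1))
    (num := fun n => (NormedSpace.exp (-(β : ℂ) • hamiltonian (n + 1) J h) *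
      totalSpin (n + 1)).trace / (n + 1 : ℕ))
    (den := fun n => (NormedSpace.exp (-(β : ℂ) • hamiltonian (n + 1) J h)).trace)
    (tendsto_mul_parityRate_pow J h β 3 1) ?_ ?_ (hmag half_mem_Icc) (hmag zero_mem_Icc)
    (fun n => hparity n (isModeSystem_antiperiodic (n + 1)))
    (fun n => hparity n (isModeSystem_periodic (n + 1)))
    (fun n => norm_twistedTrace_neg_one_one_le_mul (isModeSystem_antiperiodic (n + 1)) J h β
      (by norm_num) 1)
    (fun n => norm_twistedTrace_neg_one_one_le_mul (isModeSystem_periodic (n + 1)) J h β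
      (by norm_num) 1)
  · refine key.congr fun n => ?_
    rw [finiteMagnetization, thermalAvg, div_right_comm]
    rfl
  · filter_upwards [eventually_ge_atTop 1] with n hn
    have h1 := trace_exp_hamiltonian_mul (Nat.succ_le_succ hn) J h β 0 (hcomm n)
      (Commute.one_left _)
    have hn0 : ((n + 1 : ℕ) : ℂ) ≠ 0 := Nat.cast_ne_zero.2 n.succ_ne_zero
    simp only [heisenberg_zero, twistedHeisenberg_zero, mul_one] at h1
    rw [twistedTrace_totalSpin (isModeSystem_antiperiodic (n + 1)) J h β
        (one_add_boltzmann_ne_zero J h β _),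
      twistedTrace_totalSpin (isModeSystem_periodic (n + 1)) J h β
        (one_add_boltzmann_ne_zero J h β _),
      twistedTrace_one_one (isModeSystem_antiperiodic _),
      twistedTrace_one_one (isModeSystem_periodic _)] at h1
    rw [← mul_div_assoc, h1]
    field_simp
  · filter_upwards [eventually_ge_atTop 1] with n hn
    exact two_mul_trace_exp_hamiltonian (Nat.succ_le_succ hn) J h β

end Thermodynamic

/-! ### Integral representations -/

section Integrals

lemma integral_exp_int_mul (k : ℤ) :
    ∫ p in (-Real.pi)..Real.pi, Complex.exp (Complex.I * (k * p)) =
      if k = 0 then (2 * Real.pi : ℂ) else 0 := by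
  split_ifs with h
  · subst h
    simp
    ring
  · have hc : Complex.I * k ≠ 0 := mul_ne_zero Complex.I_ne_zero (Int.cast_ne_zero.2 h)
    have h1 := integral_exp_mul_complex (a := -Real.pi) (b := Real.pi) hc
    simp only [mul_assoc] at h1
    rw [h1, div_eq_zero_iff]
    left
    rw [sub_eq_zero, Complex.exp_eq_exp_iff_exists_int]
    exact ⟨k, by push_cast; ring⟩

lemma one_sub_fermi (J h β p : ℝ) :
    1 - fermi J h β p = 1 / (1 + Real.exp (-β * energy J h p)) := by
  have := Real.exp_pos (-β * energy J h p)
  rw [fermi]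
  field_simp
  ring

lemma fermi_eq (J h β p : ℝ) : fermi J h β p = 1 / (1 + Real.exp (β * energy J h p)) := by
  have := Real.exp_pos (β * energy J h p)
  rw [fermi, neg_mul, Real.exp_neg]
  field_simp
  ring

lemma tanh_half_energy (J h β p : ℝ) :
    Real.tanh (β * energy J h p / 2) = 1 - 2 * fermi J h β p := by
  have h1 := Real.exp_pos (β * energy J h p / 2)
  have h2 : Real.exp (β * energy J h p) = Real.exp (β * energy J h p / 2) ^ 2 := by
    rw [← Real.exp_nat_mul]; congr 1; push_cast; ring
  rw [fermi_eq, h2, Real.tanh_eq, Real.exp_neg]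
  field_simp
  ring

lemma magnetization_integral (J h β : ℝ) :
    ((∫ p in (-Real.pi)..Real.pi, Real.tanh (β * energy J h p / 2) / (4 * Real.pi) : ℝ) : ℂ) =
      1 / 2 * (1 - 2 * density J h β) := by
  have hπ : (Real.pi : ℂ) ≠ 0 := Complex.ofReal_ne_zero.2 Real.pi_ne_zero
  simp only [tanh_half_energy]
  rw [intervalIntegral.integral_div, intervalIntegral.integral_sub (by simp)
    (((continuous_fermi J h β).intervalIntegrable _ _).const_mul 2),
    intervalIntegral.integral_const_mul, density, intervalIntegral.integral_ofReal]
  simp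
  field_simp
  ring

/-- The phase `e^{i(mp - tε(p))}`. -/
def wave (J h t : ℝ) (m : ℕ) (p : ℝ) : ℂ := Complex.exp (Complex.I * (m * p - t * energy J h p : ℝ))

lemma modePhase_eq_wave (J h t : ℝ) (m : ℕ) (p : ℝ) :
    modePhase J h t m (bandFactor p) = (-1) ^ m * wave J h t m p := modePhase_bandFactor J h t m p

lemma continuous_wave (J h t : ℝ) (m : ℕ) : Continuous (wave J h t m) := by
  have := continuous_energy J h
  unfold wave
  fun_prop

lemma wave_inv (J h t : ℝ) (m : ℕ) (p : ℝ) :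
    (wave J h t m p)⁻¹ = Complex.exp (-Complex.I * (m * p - t * energy J h p : ℝ)) := by
  rw [wave, ← Complex.exp_neg, neg_mul]

lemma conj_wave (J h t : ℝ) (m : ℕ) (p : ℝ) :
    (starRingEnd ℂ) (wave J h t m p) = (wave J h t m p)⁻¹ := by
  rw [wave_inv, wave, ← Complex.exp_conj, map_mul, Complex.conj_I, Complex.conj_ofReal]

lemma neg_one_pow_mul_self (m : ℕ) : ((-1 : ℂ) ^ m) * (-1) ^ m = 1 := by
  rw [← mul_pow]; simp

/-- The signs `(-1) ^ m` from the momentum shift occur once in each propagator and cancel. -/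
lemma particleLimit_mul_holeLimit (J h β t : ℝ) (m : ℕ) :
    4 * (particleLimit J h β t m * holeLimit J h β t m) =
      (∫ p in (-Real.pi)..Real.pi, (fermi J h β p : ℂ) * wave J h t m p / Real.pi) *
        ∫ p in (-Real.pi)..Real.pi, (1 - fermi J h β p : ℂ) * (wave J h t m p)⁻¹ / Real.pi := by
  have hπ : (Real.pi : ℂ) ≠ 0 := Complex.ofReal_ne_zero.2 Real.pi_ne_zero
  have hs := neg_one_pow_mul_self m
  have hinv : ((-1 : ℂ) ^ m)⁻¹ = (-1) ^ m := inv_eq_of_mul_eq_one_left hs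
  simp only [particleLimit, holeLimit, modePhase_eq_wave, mul_inv, hinv, mul_left_comm _ ((-1 : ℂ) ^ m),
    intervalIntegral.integral_const_mul, intervalIntegral.integral_div]
  set A := ∫ p in (-Real.pi)..Real.pi, (fermi J h β p : ℂ) * wave J h t m p
  set B := ∫ p in (-Real.pi)..Real.pi, (1 - fermi J h β p : ℂ) * (wave J h t m p)⁻¹
  field_simp
  linear_combination 4 * A * B * hs

lemma correlationLimit_zero (J h β : ℝ) (m : ℕ) :
    correlationLimit J h β 0 m = (1 - 2 * density J h β) ^ 2 +
      (if m = 0 then 4 * density J h β else 0) -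
      ((‖∫ p in (-Real.pi)..Real.pi, (fermi J h β p : ℂ) * wave J h 0 m p / Real.pi‖ ^ 2 : ℝ) : ℂ) := by
  have hπ : (Real.pi : ℂ) ≠ 0 := Complex.ofReal_ne_zero.2 Real.pi_ne_zero
  have hf : Continuous fun p => (fermi J h β p : ℂ) :=
    Complex.continuous_ofReal.comp (continuous_fermi J h β)
  have hwi : Continuous fun p => (wave J h 0 m p)⁻¹ :=
    (continuous_wave J h 0 m).inv₀ fun p => Complex.exp_ne_zero _
  have hwi0 : ∀ p, (wave J h 0 m p)⁻¹ = Complex.exp (Complex.I * ((-m : ℤ) * p)) := fun p => by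
    rw [wave_inv]; push_cast; congr 1; ring
  rw [correlationLimit, particleLimit_mul_holeLimit]
  set A := ∫ p in (-Real.pi)..Real.pi, (fermi J h β p : ℂ) * wave J h 0 m p / Real.pi with hA
  -- At time zero the part without `fermi` is a pure Fourier integral, nonzero only for `m = 0`; the
  -- rest is the conjugate of the particle integral.
  have hB : ∫ p in (-Real.pi)..Real.pi, (1 - fermi J h β p : ℂ) * (wave J h 0 m p)⁻¹ / Real.pi =
      (if m = 0 then 2 else 0) - (starRingEnd ℂ) A := by
    rw [hA, ← intervalIntegral.intervalIntegral_conj]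
    simp only [map_mul, map_div₀, Complex.conj_ofReal, conj_wave, sub_mul, one_mul, sub_div]
    have hi : Continuous fun p => (fermi J h β p : ℂ) * (wave J h 0 m p)⁻¹ / Real.pi :=
      (hf.mul hwi).div_const _
    rw [intervalIntegral.integral_sub ((hwi.div_const _).intervalIntegrable _ _)
      (hi.intervalIntegrable _ _)]
    congr 1
    simp only [hwi0, intervalIntegral.integral_div, integral_exp_int_mul, neg_eq_zero,
      Nat.cast_eq_zero]
    split_ifs
    · field_simp
    · simp
  have hA0 : m = 0 → A = 2 * density J h β := by
    rintro rfl
    rw [hA, density, intervalIntegral.integral_div]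
    have : ∀ p, wave J h 0 0 p = 1 := fun p => by simp [wave]
    simp only [this, mul_one]
    field_simp
  rw [hB, mul_sub, Complex.mul_conj, Complex.normSq_eq_norm_sq, add_sub_assoc]
  congr 2
  split_ifs with h0
  · rw [hA0 h0]; ring
  · simp

/-- Continuity in time gives the static limit, and continuity at `β = 0` gives the limit of infinite
temperature. -/
lemma continuous_correlationLimit (J h : ℝ) (m : ℕ) :
    Continuous fun q : ℝ × ℝ => correlationLimit J h q.1 q.2 m := by
  have he := continuous_energy J h
  have hf : Continuous fun x : (ℝ × ℝ) × ℝ => (fermi J h x.1.1 x.2 : ℂ) := by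
    refine Complex.continuous_ofReal.comp ?_
    unfold fermi
    exact (by fun_prop : Continuous fun x : (ℝ × ℝ) × ℝ => Real.exp (-x.1.1 * energy J h x.2)).div
      (by fun_prop) fun p => by positivity
  have hw : Continuous fun x : (ℝ × ℝ) × ℝ => modePhase J h x.1.2 m (bandFactor x.2) := by
    simp only [modePhase_bandFactor]
    fun_prop
  have hwi := hw.inv₀ fun x => modePhase_bandFactor_ne_zero J h x.1.2 m x.2
  have h1 : Continuous fun q : ℝ × ℝ => density J h q.1 :=
    (intervalIntegral.continuous_parametric_intervalIntegral_of_continuous' (by exact hf)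
      _ _).const_mul _
  have h2 : Continuous fun q : ℝ × ℝ => particleLimit J h q.1 q.2 m :=
    (intervalIntegral.continuous_parametric_intervalIntegral_of_continuous' (by exact hf.mul hw)
      _ _).const_mul _
  have h3 : Continuous fun q : ℝ × ℝ => holeLimit J h q.1 q.2 m :=
    (intervalIntegral.continuous_parametric_intervalIntegral_of_continuous'
      (by exact (continuous_const.sub hf).mul hwi) _ _).const_mul _
  unfold correlationLimit
  fun_prop

/-! ### The Bessel function -/

/-- With `c = i x / 2` one has `exp (i x cos p) = exp (c e^{ip}) exp (c e^{-ip})`. The double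
exponential series is integrated termwise, dominated by a summable family of constants, and
orthogonality keeps one diagonal. -/
lemma integral_exp_cos (m : ℕ) (x : ℝ) :
    ∫ p in (-Real.pi)..Real.pi, Complex.exp (Complex.I * (m * p + x * Real.cos p : ℝ)) =
      2 * Real.pi * Complex.I ^ m * besselJ m x := by
  set c : ℂ := Complex.I * x / 2 with hc
  let F : ℕ × ℕ → ℝ → ℂ := fun n p =>
    (c ^ n.1 / (n.1.factorial : ℂ)) * (c ^ n.2 / (n.2.factorial : ℂ)) *
      Complex.exp (Complex.I * (((n.1 : ℤ) - n.2 + m : ℤ) * p))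
  have hexp : ∀ z : ℂ, HasSum (fun n : ℕ => z ^ n / (n.factorial : ℂ)) (Complex.exp z) := fun z => by
    rw [Complex.exp_eq_exp_ℂ]; exact NormedSpace.expSeries_div_hasSum_exp z
  have hnorm : ∀ z : ℂ, Summable fun n : ℕ => ‖z ^ n / (n.factorial : ℂ)‖ := fun z =>
    NormedSpace.norm_expSeries_div_summable z
  have hFnorm : ∀ n p, ‖F n p‖ =
      ‖c ^ n.1 / (n.1.factorial : ℂ)‖ * ‖c ^ n.2 / (n.2.factorial : ℂ)‖ := fun n p => by
    have h1 : Complex.I * (((n.1 : ℤ) - n.2 + m : ℤ) * p) =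
      (((((n.1 : ℤ) - n.2 + m : ℤ) : ℝ) * p : ℝ) : ℂ) * Complex.I := by push_cast; ring
    simp only [F]
    rw [h1, norm_mul, norm_mul, Complex.norm_exp_ofReal_mul_I, mul_one]
  have hsum : Summable fun n : ℕ × ℕ =>
      ‖c ^ n.1 / (n.1.factorial : ℂ)‖ * ‖c ^ n.2 / (n.2.factorial : ℂ)‖ :=
    (hnorm c).mul_of_nonneg (hnorm c) (fun _ => norm_nonneg _) (fun _ => norm_nonneg _)
  have hFsum : ∀ p : ℝ, HasSum (fun n => F n p)
      (Complex.exp (Complex.I * (m * p + x * Real.cos p : ℝ))) := by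
    intro p
    have e1 := (hexp (c * Complex.exp (Complex.I * p)))
    have e2 := (hexp (c * Complex.exp (-(Complex.I * p))))
    have hs := summable_mul_of_summable_norm (hnorm (c * Complex.exp (Complex.I * p)))
      (hnorm (c * Complex.exp (-(Complex.I * p))))
    have h1 := (e1.mul e2 hs).mul_right (Complex.exp (Complex.I * (m * p)))
    have e3 : (fun n => F n p) = fun n : ℕ × ℕ =>
        (c * Complex.exp (Complex.I * p)) ^ n.1 / (n.1.factorial : ℂ) *
          ((c * Complex.exp (-(Complex.I * p))) ^ n.2 / (n.2.factorial : ℂ)) *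
            Complex.exp (Complex.I * (m * p)) := by
      funext n
      have : Complex.exp (Complex.I * (((n.1 : ℤ) - n.2 + m : ℤ) * p)) =
          Complex.exp (n.1 * (Complex.I * p)) * Complex.exp (n.2 * -(Complex.I * p)) *
            Complex.exp (Complex.I * (m * p)) := by
        rw [← Complex.exp_add, ← Complex.exp_add]; congr 1; push_cast; ring
      simp only [F, mul_pow, ← Complex.exp_nat_mul]
      rw [this]
      ring
    have e4 : Complex.exp (Complex.I * (m * p + x * Real.cos p : ℝ)) =
        Complex.exp (c * Complex.exp (Complex.I * p)) *
          Complex.exp (c * Complex.exp (-(Complex.I * p))) * Complex.exp (Complex.I * (m * p)) := by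
      rw [← Complex.exp_add, ← Complex.exp_add, ← mul_add]
      congr 1
      have h2 := Complex.two_cos (p : ℂ)
      rw [mul_comm (p : ℂ), show -(p : ℂ) * Complex.I = -(Complex.I * p) by ring] at h2
      rw [← h2, hc]
      push_cast
      ring
    rw [e3, e4]
    exact h1
  have hint := intervalIntegral.hasSum_integral_of_dominated_convergence (μ := MeasureTheory.volume)
    (a := -Real.pi) (b := Real.pi) (F := F)
    (f := fun p => Complex.exp (Complex.I * (m * p + x * Real.cos p : ℝ)))
    (fun n _ => ‖c ^ n.1 / (n.1.factorial : ℂ)‖ * ‖c ^ n.2 / (n.2.factorial : ℂ)‖)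
    (fun n => by
      have : Continuous (F n) := by simp only [F]; fun_prop
      exact this.aestronglyMeasurable)
    (fun n => Eventually.of_forall fun p _ => (hFnorm n p).le)
    (Eventually.of_forall fun p _ => hsum) (by simp)
    (Eventually.of_forall fun p _ => hFsum p)
  have hval : ∀ n : ℕ × ℕ, ∫ p in (-Real.pi)..Real.pi, F n p =
      (c ^ n.1 / (n.1.factorial : ℂ)) * (c ^ n.2 / (n.2.factorial : ℂ)) *
        (if n.2 = n.1 + m then (2 * Real.pi : ℂ) else 0) := fun n => by
    simp only [F, intervalIntegral.integral_const_mul, integral_exp_int_mul]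
    congr 1
    refine if_congr ?_ rfl rfl
    omega
  simp only [hval] at hint
  -- The surviving diagonal consists of the pairs `(a, a + m)`, so the double sum becomes the Bessel
  -- series in `a`.
  have hinj : Function.Injective fun a : ℕ => (a, a + m) := fun a b hab => (Prod.mk.inj hab).1
  rw [← hinj.hasSum_iff (by
    rintro ⟨a, b⟩ hab
    rw [if_neg, mul_zero]
    intro e
    exact hab ⟨a, Prod.ext rfl e.symm⟩)] at hint
  have hterm : ∀ a : ℕ, ((fun n : ℕ × ℕ => (c ^ n.1 / (n.1.factorial : ℂ)) *
      (c ^ n.2 / (n.2.factorial : ℂ)) * (if n.2 = n.1 + m then (2 * Real.pi : ℂ) else 0)) ∘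
        fun a : ℕ => (a, a + m)) a = 2 * Real.pi * Complex.I ^ m *
      (((-1) ^ a / ((a.factorial : ℝ) * ((a + m).factorial : ℝ)) * (x / 2) ^ (2 * a + m) : ℝ) : ℂ) := by
    intro a
    have hI : Complex.I ^ (2 * a + m) = (-1) ^ a * Complex.I ^ m := by
      rw [pow_add, pow_mul, Complex.I_sq]
    have hc' : c ^ a * c ^ (a + m) = (-1) ^ a * Complex.I ^ m * (x / 2 : ℂ) ^ (2 * a + m) := by
      rw [← pow_add, ← hI, ← mul_pow, hc]; congr 1 <;> ring
    simp only [Function.comp, if_true]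
    push_cast
    rw [div_mul_div_comm, hc']
    ring
  rw [funext hterm] at hint
  rw [← hint.tsum_eq, tsum_mul_left, besselJ, Complex.ofReal_tsum]

lemma integral_wave (J h t : ℝ) (m : ℕ) :
    ∫ p in (-Real.pi)..Real.pi, wave J h t m p =
      Complex.exp (-(Complex.I * (t * h : ℝ))) *
        (2 * Real.pi * Complex.I ^ m * besselJ m (4 * J * t)) := by
  rw [← integral_exp_cos, ← intervalIntegral.integral_const_mul]
  congr 1
  funext p
  rw [wave, energy, ← Complex.exp_add]
  congr 1
  push_cast
  ring

/-- At `β = 0` every mode is half filled: the disconnected part vanishes, and the two propagators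
become complex conjugates, so the field phase and `i ^ m` drop out of their product. -/
lemma correlationLimit_infinite_temperature (J h t : ℝ) (m : ℕ) :
    correlationLimit J h 0 t m = ((besselJ m (4 * J * t) ^ 2 : ℝ) : ℂ) := by
  have hπ : (Real.pi : ℂ) ≠ 0 := Complex.ofReal_ne_zero.2 Real.pi_ne_zero
  have hf : ∀ p, fermi J h 0 p = 1 / 2 := fun p => by
    rw [fermi]; norm_num
  have hd : density J h 0 = 1 / 2 := by
    simp only [density, hf]
    simp
    field_simp
    ring
  have hB : ∫ p in (-Real.pi)..Real.pi, (wave J h t m p)⁻¹ =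
      (starRingEnd ℂ) (∫ p in (-Real.pi)..Real.pi, wave J h t m p) := by
    rw [← intervalIntegral.intervalIntegral_conj]; simp only [conj_wave]
  have hnorm : ‖∫ p in (-Real.pi)..Real.pi, wave J h t m p‖ =
      2 * Real.pi * |besselJ m (4 * J * t)| := by
    rw [integral_wave, norm_mul, show -(Complex.I * ((t * h : ℝ) : ℂ)) =
      ((-(t * h) : ℝ) : ℂ) * Complex.I by push_cast; ring, Complex.norm_exp_ofReal_mul_I, one_mul,
      norm_mul, norm_mul, norm_mul, norm_pow, Complex.norm_I, one_pow, mul_one, Complex.norm_real,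
      Complex.norm_real, Real.norm_of_nonneg Real.pi_pos.le, Real.norm_eq_abs]
    norm_num
  have h12 : (1 : ℂ) - ((1 / 2 : ℝ) : ℂ) = 1 / 2 := by push_cast; norm_num
  rw [correlationLimit, particleLimit_mul_holeLimit, hd]
  simp only [hf, h12, intervalIntegral.integral_div, intervalIntegral.integral_const_mul, hB]
  set A := ∫ p in (-Real.pi)..Real.pi, wave J h t m p
  have h1 : A * (starRingEnd ℂ) A = ((4 * Real.pi ^ 2 * besselJ m (4 * J * t) ^ 2 : ℝ) : ℂ) := by
    rw [Complex.mul_conj, Complex.normSq_eq_norm_sq, hnorm, mul_pow, sq_abs, mul_pow]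
    norm_num
  push_cast at h1 ⊢
  field_simp
  linear_combination h1

/-! ### The limits defining the correlation functions -/

lemma magnetization_eq (J h β : ℝ) : magnetization J h β = 1 / 2 * (1 - 2 * density J h β) :=
  (tendsto_finiteMagnetization J h β).limUnder_eq

lemma dynCorr_eq (J h β t : ℝ) (m : ℕ) : dynCorr J h β t m = correlationLimit J h β t m :=
  (tendsto_finiteDynCorr J h β t m).limUnder_eq

lemma staticCorr_eq (J h β : ℝ) (m : ℕ) : staticCorr J h β m = correlationLimit J h β 0 m :=
  (tendsto_finiteStaticCorr J h β m).limUnder_eq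

lemma fermi_mul_wave (J h T t : ℝ) (m : ℕ) (p : ℝ) :
    (fermi J h (1 / T) p : ℂ) * wave J h t m p =
      Complex.exp (Complex.I * (m * p - t * energy J h p : ℝ)) /
        (1 + Real.exp (energy J h p / T) : ℝ) := by
  rw [fermi_eq, wave, one_div_mul_eq_div, mul_comm]
  push_cast
  ring

lemma one_sub_fermi_mul_wave_inv (J h T t : ℝ) (m : ℕ) (p : ℝ) :
    (1 - fermi J h (1 / T) p : ℂ) * (wave J h t m p)⁻¹ =
      Complex.exp (-Complex.I * (m * p - t * energy J h p : ℝ)) /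
        (1 + Real.exp (-energy J h p / T) : ℝ) := by
  have h1 : (1 - fermi J h (1 / T) p : ℂ) = ((1 - fermi J h (1 / T) p : ℝ) : ℂ) := by push_cast; rfl
  rw [h1, one_sub_fermi, wave_inv,
    show -(1 / T) * energy J h p = -energy J h p / T by ring]
  push_cast
  ring

end Integrals

end

end XXChain

/-! ### The main theorem, at `β = 1 / T` and at `β = 0` -/

theorem mainTheorem4 (J h t : ℝ) (m : ℕ) (hJ : 0 < J) :
    (∀ T : ℝ, 0 < T →
      -- the magnetization
      (Tendsto (fun n : ℕ => XXChain.finiteMagnetization (n + 1) J h (1 / T)) atTop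
          (𝓝 (XXChain.magnetization J h (1 / T))) ∧
        XXChain.magnetization J h (1 / T) =
          ((∫ p in (-Real.pi)..Real.pi,
            Real.tanh (XXChain.energy J h p / (2 * T)) / (4 * Real.pi) : ℝ) : ℂ)) ∧
      -- the dynamical correlation function
      (Tendsto (fun n : ℕ => XXChain.finiteDynCorr (n + 1) J h (1 / T) t m) atTop
          (𝓝 (XXChain.dynCorr J h (1 / T) t m)) ∧
        XXChain.dynCorr J h (1 / T) t m =
          4 * XXChain.magnetization J h (1 / T) ^ 2 +
            (∫ p in (-Real.pi)..Real.pi,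
              Complex.exp (Complex.I * (m * p - t * XXChain.energy J h p : ℝ)) /
                (1 + Real.exp (XXChain.energy J h p / T) : ℝ) / Real.pi) *
            (∫ p in (-Real.pi)..Real.pi,
              Complex.exp (-Complex.I * (m * p - t * XXChain.energy J h p : ℝ)) /
                (1 + Real.exp (-XXChain.energy J h p / T) : ℝ) / Real.pi)) ∧
      -- the static correlation function
      (Tendsto (fun n : ℕ => XXChain.finiteStaticCorr (n + 1) J h (1 / T) m) atTop
          (𝓝 (XXChain.staticCorr J h (1 / T) m)) ∧
        XXChain.staticCorr J h (1 / T) m =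
          4 * XXChain.magnetization J h (1 / T) ^ 2 +
            (if m = 0 then 2 - 4 * XXChain.magnetization J h (1 / T) else 0) -
            ((‖∫ p in (-Real.pi)..Real.pi,
              Complex.exp (Complex.I * (m * p : ℝ)) /
                (1 + Real.exp (XXChain.energy J h p / T) : ℝ) / Real.pi‖ ^ 2 : ℝ) : ℂ) ∧
        Tendsto (fun τ : ℝ => XXChain.dynCorr J h (1 / T) τ m) (𝓝 0)
          (𝓝 (XXChain.staticCorr J h (1 / T) m)))) ∧
    -- infinite temperature
    (Tendsto (fun n : ℕ => XXChain.finiteDynCorr (n + 1) J h 0 t m) atTop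
        (𝓝 (XXChain.dynCorr J h 0 t m)) ∧
      XXChain.dynCorr J h 0 t m = ((XXChain.besselJ m (4 * J * t) ^ 2 : ℝ) : ℂ) ∧
      Tendsto (fun T : ℝ => XXChain.dynCorr J h (1 / T) t m) atTop
        (𝓝 ((XXChain.besselJ m (4 * J * t) ^ 2 : ℝ) : ℂ))) := by
  have hcont := XXChain.continuous_correlationLimit J h m
  refine ⟨fun T hT => ⟨⟨?_, ?_⟩, ⟨?_, ?_⟩, ?_, ?_, ?_⟩, ?_, ?_, ?_⟩
  · rw [XXChain.magnetization_eq]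
    exact XXChain.tendsto_finiteMagnetization J h (1 / T)
  · rw [XXChain.magnetization_eq, ← XXChain.magnetization_integral]
    have e : ∀ p, XXChain.energy J h p / (2 * T) = 1 / T * XXChain.energy J h p / 2 := fun p => by
      field_simp
    simp only [e]
  · rw [XXChain.dynCorr_eq]
    exact XXChain.tendsto_finiteDynCorr J h (1 / T) t m
  · rw [XXChain.dynCorr_eq, XXChain.magnetization_eq, XXChain.correlationLimit,
      XXChain.particleLimit_mul_holeLimit]
    simp only [XXChain.fermi_mul_wave, XXChain.one_sub_fermi_mul_wave_inv]
    ring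
  · rw [XXChain.staticCorr_eq]
    exact XXChain.tendsto_finiteStaticCorr J h (1 / T) m
  · rw [XXChain.staticCorr_eq, XXChain.magnetization_eq, XXChain.correlationLimit_zero]
    simp only [XXChain.fermi_mul_wave, zero_mul, sub_zero]
    -- For `m = 0` the contact term `4 * density` equals `2 - 4 * magnetization`.
    split_ifs <;> ring
  · simp only [XXChain.dynCorr_eq, XXChain.staticCorr_eq]
    exact (hcont.comp (Continuous.prodMk_right (1 / T))).tendsto 0
  · rw [XXChain.dynCorr_eq]
    exact XXChain.tendsto_finiteDynCorr J h 0 t m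
  · rw [XXChain.dynCorr_eq, XXChain.correlationLimit_infinite_temperature]
  · simp only [XXChain.dynCorr_eq]
    rw [← XXChain.correlationLimit_infinite_temperature J h t m]
    have h1 : Tendsto (fun T : ℝ => 1 / T) atTop (𝓝 0) := by
      simpa only [one_div] using tendsto_inv_atTop_zero
    -- Infinite temperature is the value at `β = 0` of a function continuous there.
    exact ((hcont.comp (Continuous.prodMk_left t)).tendsto 0).comp h1
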